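/- Let $X$ be a standard Borel space with a non-atomic probability measure $\mu$, and let $\mathrm{Aut}(X,\mu)$ be the group of $\mu$-preserving Borel automorphisms of $X$, two automorphisms being identified if they agree $\mu$-almost everywhere. Equip it with the strong (also called weak) topology, that is, the topology induced by the strong operator topology through the unitary representation $\Phi(T)f=f\circ T^{-1}$ on $L^2(X,\mu)$. Then: (a) $\mathrm{Aut}(X,\mu)$ is a Lévy group: it is a metrizable topological group $G$ that has a net $(G_\alpha)_{\alpha\in A}$ of compact subgroups such that, for every compatible right-invariant metric $d$ on $G$ (and such metrics exist), 1. if $\mu_\alpha$ denotes the normalized Haar measure of $G_\alpha$, regarded as a Borel measure on $G$, then $(G,d,\mu_\alpha)_{\alpha\in A}$ is a Lévy family: for all Borel sets $A_\alpha\subseteq G$ with $\liminf_\alpha\mu_\alpha(A_\alpha)>0$ and every $\varepsilon>0$, one has $\lim_\alpha\mu_\alpha\bigl((A_\alpha)_\varepsilon\bigr)=1$, where $(A_\alpha)_\varepsilon$ is the $\varepsilon$-neighbourhood of $A_\alpha$ with respect to $d$; 2. for all $g_1,\dots,g_N\in G$ and every $\varepsilon>0$ there is an $\alpha\in A$ such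 that $d(g_i,G_\beta)<\varepsilon$ for all $\beta\ge\alpha$ and $i=1,\dots,N$. (b) $\mathrm{Aut}(X,\mu)$ is extremely amenable: every continuous action of it on a nonempty compact Hausdorff space has a fixed point. -/

import Mathlib

open MeasureTheory Filter Topology TopologicalSpace
open scoped ENNReal

universe u v

noncomputable section

/-! ### Lévy families, Lévy groups, extreme amenability -/

/-- A net `(X α, d α, μ α)` of `mm`-spaces (metric spaces with a Borel probability measure) is a
*Lévy family* if for all Borel sets `A α ⊆ X α` with `liminf μ α (A α) > 0` and every `ε > 0` the
measures of the `ε`-neighbourhoods of the `A α` converge to `1`. -/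
def IsLevyFamily {ι : Type*} [Preorder ι] (X : ι → Type*) [∀ α, MetricSpace (X α)]
    [∀ α, MeasurableSpace (X α)] [∀ α, BorelSpace (X α)] (μ : ∀ α, Measure (X α)) : Prop :=
  (∀ α, IsProbabilityMeasure (μ α)) ∧
    ∀ A : ∀ α, Set (X α), (∀ α, MeasurableSet (A α)) →
      0 < liminf (fun α => μ α (A α)) atTop →
      ∀ ε : ℝ, 0 < ε → Tendsto (fun α => μ α (Metric.thickening ε (A α))) atTop (𝓝 1)

/-- The normalized Haar measure of a compact subgroup `K` of a topological group `G`, as a Borel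
measure on `G`. -/
def compactHaar {G : Type*} [Group G] [TopologicalSpace G] [IsTopologicalGroup G]
    [MeasurableSpace G] [BorelSpace G] (K : Subgroup G) (hK : IsCompact (K : Set G)) :
    Measure G :=
  haveI : CompactSpace K := isCompact_iff_compactSpace.mp hK
  (Measure.haarMeasure (⊤ : PositiveCompacts K)).map Subtype.val

/-- A metric `d` on a topological group `G` is compatible and right-invariant if it induces the
topology of `G` and `d (a * c, b * c) = d (a, b)`. -/
structure IsCompatibleRightInvariant {G : Type*} [Group G] [t : TopologicalSpace G]
    (d : MetricSpace G) : Prop where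
  compatible : t = d.toPseudoMetricSpace.toUniformSpace.toTopologicalSpace
  right_invariant : ∀ a b c : G, d.dist (a * c) (b * c) = d.dist a b

/-- The two conditions, for a compatible right-invariant metric `d` on `G`, on a net `K` of compact
subgroups of `G`: the `mm`-spaces `(G, d, μ α)`, where `μ α` is the normalized Haar measure of
`K α`, form a Lévy family, and finitely many elements of `G` are eventually `ε`-close to `K β`. -/
def IsLevyNet {G : Type*} [Group G] [TopologicalSpace G] [IsTopologicalGroup G]
    {ι : Type*} [Preorder ι] (K : ι → Subgroup G) (hK : ∀ α, IsCompact (K α : Set G))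
    (d : MetricSpace G) (hd : IsCompatibleRightInvariant d) : Prop :=
  letI : MeasurableSpace G := borel G
  haveI : BorelSpace G := ⟨rfl⟩
  -- the metric `d`, with its topology replaced by the (propositionally equal) one of `G`
  letI : MetricSpace G := d.replaceTopology hd.compatible
  IsLevyFamily (fun _ : ι => G) (fun α => compactHaar (K α) (hK α)) ∧
    ∀ (F : Finset G) (ε : ℝ), 0 < ε →
      ∃ α : ι, ∀ β : ι, α ≤ β → ∀ g ∈ F, Metric.infDist g (K β : Set G) < ε

/-- A *Lévy group*: a metrizable topological group with a net (indexed by a nonempty directed set)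
of compact subgroups that satisfies the two conditions of `IsLevyNet` for every compatible
right-invariant metric. Such metrics exist on every metrizable group (Birkhoff and Kakutani); their
existence is recorded explicitly, so that "for every" includes "for some". -/
def IsLevyGroup (G : Type u) [Group G] [TopologicalSpace G] : Prop :=
  ∃ _ : IsTopologicalGroup G, MetrizableSpace G ∧
    (∃ d : MetricSpace G, IsCompatibleRightInvariant d) ∧
    ∃ (ι : Type u) (_ : Preorder ι) (_ : IsDirectedOrder ι) (_ : Nonempty ι)
      (K : ι → Subgroup G) (hK : ∀ α, IsCompact (K α : Set G)),
      ∀ (d : MetricSpace G) (hd : IsCompatibleRightInvariant d), IsLevyNet K hK d hd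

/-- A topological group is *extremely amenable* if each of its (jointly) continuous actions on a
nonempty compact Hausdorff space has a fixed point. -/
def IsExtremelyAmenable (G : Type u) [Group G] [TopologicalSpace G] : Prop :=
  ∀ (Y : Type v) [TopologicalSpace Y] [CompactSpace Y] [T2Space Y] [Nonempty Y]
    [MulAction G Y] [ContinuousSMul G Y], ∃ y : Y, ∀ g : G, g • y = y

/-! ### The group `Aut (X, μ)` with the strong topology -/

section Aut

variable {X : Type u} [MeasurableSpace X]

/-- Measure-preserving Borel automorphisms of `(X, μ)`, before identification modulo `μ`. -/
def BorelAut (μ : Measure X) : Type u :=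
  {T : X ≃ᵐ X // MeasurePreserving T μ μ}

namespace BorelAut

variable {μ : Measure X}

/-- The group structure is composition: `(S * T) x = S (T x)`. -/
instance : Group (BorelAut μ) where
  mul S T := ⟨T.1.trans S.1, S.2.comp T.2⟩
  one := ⟨MeasurableEquiv.refl X, MeasurePreserving.id μ⟩
  inv T := ⟨T.1.symm, T.2.symm T.1⟩
  mul_assoc _ _ _ := rfl
  one_mul _ := rfl
  mul_one _ := rfl
  inv_mul_cancel T := Subtype.ext (MeasurableEquiv.ext (funext fun x => T.1.symm_apply_apply x))

/-- The normal subgroup of the automorphisms that are equal to the identity `μ`-almost everywhere.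
-/
def null (μ : Measure X) : Subgroup (BorelAut μ) where
  carrier := {T | ∀ᵐ x ∂μ, T.1 x = x}
  one_mem' := by
    change ∀ᵐ x ∂μ, x = x
    exact Eventually.of_forall fun _ => rfl
  mul_mem' {S T} hS hT := by
    filter_upwards [hT, T.2.quasiMeasurePreserving.ae hS] with x h1 h2
    exact h2.trans h1
  inv_mem' {T} hT := by
    filter_upwards [(T⁻¹).2.quasiMeasurePreserving.ae hT] with x h
    have h' : T.1 (T.1.symm x) = T.1.symm x := h
    exact h'.symm.trans (T.1.apply_symm_apply x)

instance : (null μ).Normal where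
  conj_mem T hT S := by
    have hT' : ∀ᵐ x ∂μ, T.1 x = x := hT
    change ∀ᵐ x ∂μ, S.1 (T.1 (S.1.symm x)) = x
    filter_upwards [(S⁻¹).2.quasiMeasurePreserving.ae hT'] with x h
    have h' : T.1 (S.1.symm x) = S.1.symm x := h
    rw [h', S.1.apply_symm_apply]

/-- The unitary operator `f ↦ f ∘ T⁻¹` of `L² (X, μ)`. (The density `d(μ ∘ T⁻¹)/dμ` is `1` here, as
`T` preserves `μ`.) -/
def unitaryOp (T : BorelAut μ) : Lp ℂ 2 μ ≃ₗᵢ[ℂ] Lp ℂ 2 μ :=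
  { Lp.compMeasurePreservingₗᵢ ℂ (T⁻¹).1 (T⁻¹).2 with
    invFun := Lp.compMeasurePreserving T.1 T.2
    left_inv := fun f => by
      apply Lp.ext
      refine (Lp.coeFn_compMeasurePreserving _ T.2).trans ?_
      filter_upwards [T.2.quasiMeasurePreserving.ae
        (Lp.coeFn_compMeasurePreserving f (T⁻¹).2)] with x hx
      refine hx.trans ?_
      exact congrArg f (T.1.symm_apply_apply x)
    right_inv := fun f => by
      apply Lp.ext
      refine (Lp.coeFn_compMeasurePreserving _ (T⁻¹).2).trans ?_
      filter_upwards [(T⁻¹).2.quasiMeasurePreserving.ae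
        (Lp.coeFn_compMeasurePreserving f T.2)] with x hx
      refine hx.trans ?_
      exact congrArg f (T.1.apply_symm_apply x) }

theorem coeFn_unitaryOp (T : BorelAut μ) (f : Lp ℂ 2 μ) :
    unitaryOp T f =ᵐ[μ] fun x => f (T.1.symm x) :=
  Lp.coeFn_compMeasurePreserving f (T⁻¹).2

/-- `T ↦ (f ↦ f ∘ T⁻¹)` as a group homomorphism to the unitary group of `L² (X, μ)`. -/
def unitaryRep (μ : Measure X) : BorelAut μ →* (Lp ℂ 2 μ ≃ₗᵢ[ℂ] Lp ℂ 2 μ) where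
  toFun := unitaryOp
  map_one' := by
    ext1 f
    exact Lp.ext (coeFn_unitaryOp 1 f)
  map_mul' S T := by
    ext1 f
    apply Lp.ext
    refine (coeFn_unitaryOp (S * T) f).trans ?_
    refine EventuallyEq.trans ?_ (coeFn_unitaryOp S (unitaryOp T f)).symm
    filter_upwards [(S⁻¹).2.quasiMeasurePreserving.ae (coeFn_unitaryOp T f)] with x hx
    exact hx.symm

theorem null_le_ker (μ : Measure X) : null μ ≤ (unitaryRep μ).ker := by
  intro T hT
  rw [MonoidHom.mem_ker]
  ext1 f
  apply Lp.ext
  refine (coeFn_unitaryOp T f).trans ?_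
  have h : ∀ᵐ x ∂μ, (T⁻¹).1 x = x := (null μ).inv_mem hT
  filter_upwards [h] with x hx
  exact congrArg f hx

end BorelAut

/-- `Aut (X, μ)`: the group of measure-preserving Borel automorphisms of `(X, μ)`, where
automorphisms that agree `μ`-almost everywhere are identified. -/
def MeasureAut (μ : Measure X) : Type u :=
  BorelAut μ ⧸ BorelAut.null μ

instance (μ : Measure X) : Group (MeasureAut μ) :=
  inferInstanceAs (Group (BorelAut μ ⧸ BorelAut.null μ))

/-- The representation `Φ` of `Aut (X, μ)` by unitary operators of `L² (X, μ)`. -/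
def MeasureAut.Φ (μ : Measure X) : MeasureAut μ →* (Lp ℂ 2 μ ≃ₗᵢ[ℂ] Lp ℂ 2 μ) :=
  QuotientGroup.lift (BorelAut.null μ) (BorelAut.unitaryRep μ) (BorelAut.null_le_ker μ)

/-- The strong topology on `Aut (X, μ)`: it is induced, through `Φ`, by the strong operator
topology, that is, the topology of pointwise convergence on `L² (X, μ)`. -/
instance MeasureAut.strongTopology (μ : Measure X) : TopologicalSpace (MeasureAut μ) :=
  TopologicalSpace.induced (fun T => (MeasureAut.Φ μ T : Lp ℂ 2 μ → Lp ℂ 2 μ))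
    inferInstance

end Aut

end

noncomputable section

/-! ### Concentration of measure in the symmetric groups -/

section Perm

open Equiv

/-! Modulo null sets `(X, μ)` is `[0, 1)` with Lebesgue measure. Cut the interval into `n + 1` equal
cells; permuting the cells by translations embeds the symmetric group on `n + 1` letters in `Aut (X,
μ)`. These finite subgroups form the Lévy net, for two reasons.

Concentration: a function on the symmetric group that changes by at most `c` under a transposition
has variance at most `n * c ^ 2` (`Equiv.Perm.variance_le`). Chebyshev's inequality for the Hamming
distance to a set, whose natural scale is `n`, shows that a set of fixed positive proportion has a
`δ * n`-neighbourhood of almost full proportion. A permutation that moves few cells is close to the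
identity of `Aut (X, μ)`.

Density: a measure-preserving map of the interval determines a doubly stochastic matrix of
transitions between cells. By the Birkhoff–von Neumann theorem some permutation has a transport cost
no larger than that of the matrix, and it approximates the map (`exists_perm_integral_le`).

The strong topology is already induced by the orbit map of a single vector, the coordinate function
(`isInducing_vector`), so both facts reduce to integrals over `[0, 1)`. They are recorded in
`IsPermApproximation` through neighbourhoods of points only, hence serve every compatible
right-invariant metric at once.

Extreme amenability follows by the Gromov–Milman argument: some small region of the compact space
contains a definite proportion of an orbit of a finite subgroup, so by concentration a slightly
larger region contains nearly all of it. It then contains a point of the orbit together with its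
finitely many translates, and that point is almost fixed. Compactness upgrades almost fixed points
to a fixed point. -/

theorem sum_sq_sub_mean_le {ι : Type*} [Fintype ι] [Nonempty ι] (f : ι → ℝ) (a : ℝ) :
    ∑ i, (f i - (∑ j, f j) / Fintype.card ι) ^ 2 +
      Fintype.card ι * ((∑ j, f j) / Fintype.card ι - a) ^ 2 = ∑ i, (f i - a) ^ 2 := by
  have hc : (Fintype.card ι : ℝ) ≠ 0 := by exact_mod_cast Fintype.card_ne_zero
  set m := (∑ j, f j) / Fintype.card ι with hm
  have hs : ∑ j, f j = Fintype.card ι * m := by rw [hm]; field_simp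
  have h1 : ∀ b, ∑ i, (f i - b) ^ 2 = ∑ i, f i ^ 2 - 2 * b * ∑ i, f i + Fintype.card ι * b ^ 2 := by
    intro b
    rw [Finset.mul_sum, ← Finset.sum_sub_distrib]
    have : (Fintype.card ι : ℝ) * b ^ 2 = ∑ _i : ι, b ^ 2 := by simp
    rw [this, ← Finset.sum_add_distrib]
    exact Finset.sum_congr rfl fun i _ => by ring
  rw [h1, h1, hs]
  ring

/-- A function on the symmetric group that changes by at most `c` when multiplied by a
transposition has variance at most `n * c ^ 2`. -/
theorem Equiv.Perm.variance_le {n : ℕ} {c : ℝ} (f : Perm (Fin n) → ℝ)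
    (hf : ∀ i j σ, |f (swap i j * σ) - f σ| ≤ c) :
    ∑ σ, (f σ - (∑ τ, f τ) / n.factorial) ^ 2 ≤ n * c ^ 2 * n.factorial := by
  induction n with
  | zero => simp
  | succ n ih =>
    have hcard : ∀ k : ℕ, (Fintype.card (Perm (Fin k)) : ℝ) = k.factorial := fun k => by
      rw [Fintype.card_perm, Fintype.card_fin]
    -- The symmetric group splits into the fibres `σ 0 = p`, each a copy of the smaller symmetric
    -- group. The variance is the variance inside the fibres plus the variance of the fibre means,
    -- and each fibre mean is within `c` of `m 0`.
    let e : Fin (n + 1) × Perm (Fin n) ≃ Perm (Fin (n + 1)) := Perm.decomposeFin.symm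
    have he : ∀ p τ, e (p, τ) = swap 0 p * e (0, τ) := by
      intro p τ
      ext i
      refine Fin.cases ?_ (fun i => ?_) i <;> simp [e]
    -- A transposition inside a fibre is a conjugate transposition of the whole group, so the
    -- induction hypothesis applies to each fibre with the same `c`.
    have hmul : ∀ p i j τ, e (p, swap i j * τ) =
        swap (swap 0 p i.succ) (swap 0 p j.succ) * e (p, τ) := by
      intro p i j τ
      have h0 : e (0, swap i j * τ) = swap i.succ j.succ * e (0, τ) := by
        ext k
        refine Fin.cases ?_ (fun k => ?_) k
        · simp [e, swap_apply_of_ne_of_ne (Fin.succ_ne_zero i).symm (Fin.succ_ne_zero j).symm]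
        · simp [e, (Fin.succ_injective n).swap_apply]
      rw [he p, he p, h0, swap_apply_apply]
      group
    let m : Fin (n + 1) → ℝ := fun p => (∑ τ, f (e (p, τ))) / n.factorial
    have hm : ∀ p, |m p - m 0| ≤ c := by
      intro p
      have hn : (0 : ℝ) < n.factorial := by exact_mod_cast n.factorial_pos
      rw [← sub_div, ← Finset.sum_sub_distrib, abs_div, abs_of_pos hn, div_le_iff₀ hn]
      refine (Finset.abs_sum_le_sum_abs _ _).trans ?_
      refine (Finset.sum_le_sum (g := fun _ => c) fun τ _ => ?_).trans ?_
      · rw [he p]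
        exact hf _ _ _
      · simp [Fintype.card_perm, mul_comm]
    have hfib : ∀ p, ∑ τ, (f (e (p, τ)) - m 0) ^ 2 ≤ (n + 1) * c ^ 2 * n.factorial := by
      intro p
      have h1 := sum_sq_sub_mean_le (fun τ => f (e (p, τ))) (m 0)
      have h2 := ih (fun τ => f (e (p, τ))) fun i j τ => by
        rw [hmul]
        exact hf _ _ _
      rw [hcard] at h1
      rw [← h1]
      have h3 : (m p - m 0) ^ 2 ≤ c ^ 2 := sq_le_sq' (abs_le.mp (hm p)).1 (abs_le.mp (hm p)).2
      have h4 : (n.factorial : ℝ) * (m p - m 0) ^ 2 ≤ n.factorial * c ^ 2 := by gcongr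
      change _ + (n.factorial : ℝ) * (m p - m 0) ^ 2 ≤ _
      linarith
    have h1 := sum_sq_sub_mean_le f (m 0)
    rw [hcard] at h1
    -- Deviations are measured from `m 0` rather than from the mean of `f`; this only increases the
    -- sum of squares.
    have h2 : ∑ σ, (f σ - m 0) ^ 2 ≤ (n + 1) * ((n + 1) * c ^ 2 * n.factorial) := by
      rw [← e.sum_comp, Fintype.sum_prod_type]
      refine (Finset.sum_le_sum fun p _ => hfib p).trans ?_
      simp
    have h3 : 0 ≤ ((n + 1).factorial : ℝ) * ((∑ j, f j) / (n + 1).factorial - m 0) ^ 2 := by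
      positivity
    rw [Nat.factorial_succ] at *
    push_cast at *
    linarith

/-- The number of points where two permutations differ. -/
def hammingCount {n : ℕ} (σ τ : Perm (Fin n)) : ℕ :=
  (Finset.univ.filter fun i => σ i ≠ τ i).card

/-- Multiplication by `swap i j` on the left alters `σ` only at the preimages of `i` and `j`. -/
theorem hammingCount_swap_mul_le {n : ℕ} (i j : Fin n) (σ τ : Perm (Fin n)) :
    hammingCount (swap i j * σ) τ ≤ hammingCount σ τ + 2 := by
  have : (Finset.univ.filter fun k => (swap i j * σ) k ≠ τ k) ⊆
      (Finset.univ.filter fun k => σ k ≠ τ k) ∪ {σ⁻¹ i, σ⁻¹ j} := by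
    intro k hk
    have hk : swap i j (σ k) ≠ τ k := (Finset.mem_filter.mp hk).2
    simp only [Finset.mem_filter, Finset.mem_univ, true_and, Finset.mem_union,
      Finset.mem_insert, Finset.mem_singleton, Perm.eq_inv_iff_eq]
    by_contra! h
    exact hk (by rw [swap_apply_of_ne_of_ne h.2.1 h.2.2, h.1])
  refine (Finset.card_le_card this).trans ((Finset.card_union_le _ _).trans ?_)
  exact Nat.add_le_add_left Finset.card_le_two _

open Classical in
/-- Concentration of measure in the symmetric groups with the normalized Hamming metric. -/
theorem Equiv.Perm.concentration {n : ℕ} {a δ η : ℝ} (ha : 0 < a) (hδ : 0 < δ)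
    (hn : 0 < n) (han : 16 ≤ a * δ ^ 2 * n) (hηn : 16 ≤ η * δ ^ 2 * n)
    (A : Finset (Perm (Fin n))) (hA : a * n.factorial ≤ A.card) :
    (1 - η) * n.factorial ≤
      (Finset.univ.filter fun σ => ∃ τ ∈ A, (hammingCount σ τ : ℝ) < δ * n).card := by
  have hN : (0 : ℝ) < n.factorial := by exact_mod_cast n.factorial_pos
  have hn' : (0 : ℝ) < n := by exact_mod_cast hn
  have hne : A.Nonempty := by
    rw [← Finset.card_pos]
    have : (0 : ℝ) < A.card := lt_of_lt_of_le (by positivity) hA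
    exact_mod_cast this
  let f : Perm (Fin n) → ℕ := fun σ => A.inf' hne (hammingCount σ)
  have hfA : ∀ σ ∈ A, f σ = 0 := by
    intro σ hσ
    refine Nat.le_zero.mp ((Finset.inf'_le _ hσ).trans ?_)
    simp [hammingCount]
  have hf1 : ∀ i j σ, f (swap i j * σ) ≤ f σ + 2 := by
    intro i j σ
    obtain ⟨τ, hτ, h⟩ := Finset.exists_mem_eq_inf' hne (hammingCount σ)
    change _ ≤ A.inf' hne (hammingCount σ) + 2
    rw [h]
    exact (Finset.inf'_le _ hτ).trans (hammingCount_swap_mul_le i j σ τ)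
  have hf2 : ∀ i j σ, |(f (swap i j * σ) : ℝ) - f σ| ≤ 2 := by
    intro i j σ
    have h1 := hf1 i j σ
    have h2 := hf1 i j (swap i j * σ)
    rw [← mul_assoc, swap_mul_self, one_mul] at h2
    have h1' : (f (swap i j * σ) : ℝ) ≤ f σ + 2 := by exact_mod_cast h1
    have h2' : (f σ : ℝ) ≤ f (swap i j * σ) + 2 := by exact_mod_cast h2
    rw [abs_le]
    constructor <;> linarith
  have hvar := Equiv.Perm.variance_le (fun σ => (f σ : ℝ)) hf2
  set m : ℝ := (∑ τ, (f τ : ℝ)) / n.factorial with hm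
  have hm0 : 0 ≤ m := by positivity
  -- The points of `A` alone, where `f = 0`, contribute `A.card * m ^ 2` to the variance sum; this
  -- bounds the mean of `f`.
  have hm1 : a * m ^ 2 ≤ 4 * n := by
    have h1 : ∑ σ ∈ A, ((f σ : ℝ) - m) ^ 2 ≤ ∑ σ, ((f σ : ℝ) - m) ^ 2 :=
      Finset.sum_le_sum_of_subset_of_nonneg (Finset.subset_univ _) fun _ _ _ => sq_nonneg _
    have h2 : ∑ σ ∈ A, ((f σ : ℝ) - m) ^ 2 = A.card * m ^ 2 := by
      rw [Finset.sum_congr rfl fun σ hσ => by rw [hfA σ hσ, Nat.cast_zero, zero_sub, neg_sq]]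
      simp
    have h3 : a * n.factorial * m ^ 2 ≤ A.card * m ^ 2 := by gcongr
    have h4 : (a * m ^ 2) * n.factorial ≤ (4 * n) * n.factorial := by linarith
    exact le_of_mul_le_mul_right h4 hN
  have hm2 : m ≤ δ * n / 2 := by
    refine le_of_sq_le_sq ?_ (by positivity) |> fun h => h
    have h5 : a * m ^ 2 ≤ a * (δ * n / 2) ^ 2 := by
      have : 16 * n ≤ a * δ ^ 2 * n * n := by gcongr
      nlinarith
    exact le_of_mul_le_mul_left h5 ha
  set B := Finset.univ.filter fun σ => ∃ τ ∈ A, (hammingCount σ τ : ℝ) < δ * n with hB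
  -- Chebyshev: outside `B` the distance is at least `δ * n`, while the mean is at most half of
  -- that.
  have hBc : ∀ σ ∈ Bᶜ, (δ * n / 2) ^ 2 ≤ ((f σ : ℝ) - m) ^ 2 := by
    intro σ hσ
    have : δ * n ≤ f σ := by
      obtain ⟨τ, hτ, h⟩ := Finset.exists_mem_eq_inf' hne (hammingCount σ)
      change _ ≤ ((A.inf' hne (hammingCount σ) : ℕ) : ℝ)
      rw [h]
      by_contra! hlt
      simp only [hB, Finset.mem_compl, Finset.mem_filter, Finset.mem_univ, true_and] at hσ
      exact hσ ⟨τ, hτ, hlt⟩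
    have h0 : 0 ≤ δ * n / 2 := by positivity
    gcongr
    linarith
  have h6 : (Bᶜ.card : ℝ) * (δ * n / 2) ^ 2 ≤ n * 2 ^ 2 * n.factorial := by
    refine le_trans ?_ hvar
    rw [← nsmul_eq_mul]
    exact (Finset.card_nsmul_le_sum _ _ _ hBc).trans
      (Finset.sum_le_sum_of_subset_of_nonneg (Finset.subset_univ _) fun _ _ _ => sq_nonneg _)
  have h7 : (Bᶜ.card : ℝ) ≤ η * n.factorial := by
    have h8 : (n : ℝ) * 2 ^ 2 * n.factorial ≤ (η * n.factorial) * (δ * n / 2) ^ 2 := by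
      have : 16 * ((n : ℝ) * n.factorial) ≤ η * δ ^ 2 * n * (n * n.factorial) := by gcongr
      nlinarith
    exact le_of_mul_le_mul_right (h6.trans h8) (by positivity)
  have h9 : (B.card : ℝ) + Bᶜ.card = n.factorial := by
    have := Finset.card_add_card_compl B
    rw [Fintype.card_perm, Fintype.card_fin] at this
    exact_mod_cast this
  linarith

end Perm

/-! ### Permutations of the cells of the unit interval -/

section Interval

/-- Lebesgue measure on `[0, 1)`, as a measure on the line. -/
def unitMeasure : Measure ℝ := volume.restrict (Set.Ico 0 1)

instance : IsProbabilityMeasure unitMeasure := ⟨by simp [unitMeasure]⟩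

instance : IsFiniteMeasureOnCompacts unitMeasure := by
  unfold unitMeasure; infer_instance

theorem ae_unitMeasure_mem : ∀ᵐ t ∂unitMeasure, t ∈ Set.Ico (0 : ℝ) 1 :=
  ae_restrict_mem measurableSet_Ico

/-- The index of the cell of length `1 / (n + 1)` of `[0, 1)` that contains `t`. -/
def cellIdx (n : ℕ) (t : ℝ) : Fin (n + 1) := Fin.ofNat (n + 1) ⌊(n + 1) * t⌋₊

theorem measurable_cellIdx (n : ℕ) : Measurable (cellIdx n) := by
  have h : Measurable fun t : ℝ => ⌊((n : ℝ) + 1) * t⌋₊ :=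
    Nat.measurable_floor.comp (measurable_const_mul _)
  exact (Measurable.of_discrete (f := Fin.ofNat (n + 1))).comp h

theorem cellIdx_eq_iff {n : ℕ} {t : ℝ} (ht : t ∈ Set.Ico (0 : ℝ) 1) (i : Fin (n + 1)) :
    cellIdx n t = i ↔ (i : ℝ) ≤ (n + 1) * t ∧ (n + 1) * t < i + 1 := by
  have h0 : 0 ≤ (n + 1) * t := mul_nonneg (by positivity) ht.1
  -- On `[0, 1)` the reduction modulo `n + 1` in `Fin.ofNat` does nothing.
  have h1 : ⌊(n + 1) * t⌋₊ < n + 1 := by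
    rw [Nat.floor_lt h0]
    push_cast
    have : (0 : ℝ) < n + 1 := by positivity
    nlinarith [ht.2]
  rw [← Nat.floor_eq_iff h0, Fin.ext_iff, cellIdx, Fin.val_ofNat, Nat.mod_eq_of_lt h1]

theorem cellIdx_bounds {n : ℕ} {t : ℝ} (ht : t ∈ Set.Ico (0 : ℝ) 1) :
    (cellIdx n t : ℝ) ≤ (n + 1) * t ∧ (n + 1) * t < cellIdx n t + 1 :=
  (cellIdx_eq_iff ht _).mp rfl

theorem abs_sub_cellIdx_div_le {n : ℕ} {t : ℝ} (ht : t ∈ Set.Ico (0 : ℝ) 1) :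
    |t - (cellIdx n t : ℝ) / (n + 1)| ≤ 1 / (n + 1) := by
  have hn : (0 : ℝ) < n + 1 := by positivity
  have h := cellIdx_bounds (n := n) ht
  have : t - (cellIdx n t : ℝ) / (n + 1) = ((n + 1) * t - cellIdx n t) / (n + 1) := by
    field_simp
  rw [this, abs_div, abs_of_pos hn]
  gcongr
  rw [abs_le]
  constructor <;> linarith

/-- The map of `[0, 1)` that permutes its `n + 1` cells by `σ`. -/
def cellShift (n : ℕ) (σ : Equiv.Perm (Fin (n + 1))) (t : ℝ) : ℝ :=
  t + ((σ (cellIdx n t) : ℝ) - cellIdx n t) / (n + 1)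

variable {n : ℕ}

theorem measurable_cellShift (σ : Equiv.Perm (Fin (n + 1))) : Measurable (cellShift n σ) := by
  have h : Measurable fun i : Fin (n + 1) => ((σ i : ℝ) - i) / (n + 1) := .of_discrete
  exact measurable_id.add (h.comp (measurable_cellIdx n))

theorem mul_cellShift (σ : Equiv.Perm (Fin (n + 1))) (t : ℝ) :
    (n + 1) * cellShift n σ t = (n + 1) * t + (σ (cellIdx n t) - cellIdx n t) := by
  unfold cellShift
  field_simp

theorem cellShift_mem (σ : Equiv.Perm (Fin (n + 1))) {t : ℝ} (ht : t ∈ Set.Ico (0 : ℝ) 1) :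
    cellShift n σ t ∈ Set.Ico (0 : ℝ) 1 := by
  have hn : (0 : ℝ) < n + 1 := by positivity
  have h := cellIdx_bounds (n := n) ht
  have h2 := mul_cellShift σ t
  have h3 : ((σ (cellIdx n t) : ℕ) : ℝ) + 1 ≤ n + 1 := by exact_mod_cast (σ (cellIdx n t)).2
  have h4 : (0 : ℝ) ≤ (σ (cellIdx n t) : ℕ) := by positivity
  constructor
  · by_contra! hlt
    nlinarith
  · by_contra! hlt
    nlinarith

theorem cellIdx_cellShift (σ : Equiv.Perm (Fin (n + 1))) {t : ℝ} (ht : t ∈ Set.Ico (0 : ℝ) 1) :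
    cellIdx n (cellShift n σ t) = σ (cellIdx n t) := by
  rw [cellIdx_eq_iff (cellShift_mem σ ht), mul_cellShift]
  have h := cellIdx_bounds (n := n) ht
  constructor <;> linarith

theorem cellShift_mul (σ τ : Equiv.Perm (Fin (n + 1))) {t : ℝ} (ht : t ∈ Set.Ico (0 : ℝ) 1) :
    cellShift n (σ * τ) t = cellShift n σ (cellShift n τ t) := by
  conv_rhs => rw [cellShift, cellIdx_cellShift τ ht, cellShift]
  rw [cellShift, Equiv.Perm.mul_apply]
  ring

theorem cellShift_one (t : ℝ) : cellShift n 1 t = t := by simp [cellShift]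

theorem unitMeasure_inter_cell (A : Set ℝ) (i : Fin (n + 1)) :
    unitMeasure (cellIdx n ⁻¹' {i} ∩ A) =
      volume (A ∩ Set.Ico ((i : ℝ) / (n + 1)) ((i + 1) / (n + 1))) := by
  have hn : (0 : ℝ) < n + 1 := by positivity
  have h3 : ((i : ℕ) : ℝ) + 1 ≤ n + 1 := by exact_mod_cast i.2
  rw [unitMeasure, Measure.restrict_apply' measurableSet_Ico]
  congr 1
  ext t
  simp only [Set.mem_inter_iff, Set.mem_preimage, Set.mem_singleton_iff]
  have key : t ∈ Set.Ico ((i : ℝ) / (n + 1)) ((i + 1) / (n + 1)) ↔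
      (i : ℝ) ≤ (n + 1) * t ∧ (n + 1) * t < i + 1 := by
    rw [Set.mem_Ico, div_le_iff₀ hn, lt_div_iff₀ hn, mul_comm t]
  rw [key]
  constructor
  · rintro ⟨⟨h1, h2⟩, h⟩
    exact ⟨h2, (cellIdx_eq_iff h i).mp h1⟩
  · rintro ⟨h1, h2⟩
    have ht : t ∈ Set.Ico (0 : ℝ) 1 := by
      have : (0 : ℝ) ≤ (i : ℕ) := by positivity
      constructor
      · by_contra! hlt
        nlinarith
      · by_contra! hlt
        nlinarith
    exact ⟨⟨(cellIdx_eq_iff ht i).mpr h2, h1⟩, ht⟩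

theorem unitMeasure_cell (i : Fin (n + 1)) :
    unitMeasure.real (cellIdx n ⁻¹' {i}) = 1 / (n + 1) := by
  have h := unitMeasure_inter_cell (Set.univ) i
  rw [Set.inter_univ, Set.univ_inter, Real.volume_Ico] at h
  rw [Measure.real, h, ENNReal.toReal_ofReal]
  · ring
  · rw [← sub_div]
    apply div_nonneg
    · linarith
    · positivity

/-- On cell `i` the map is a translation onto cell `σ i`. Summing over cells and reindexing by `σ`
reduces the claim to translation invariance of Lebesgue measure. -/
theorem measurePreserving_cellShift (σ : Equiv.Perm (Fin (n + 1))) :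
    MeasurePreserving (cellShift n σ) unitMeasure unitMeasure := by
  refine ⟨measurable_cellShift σ, Measure.ext fun A hA => ?_⟩
  rw [Measure.map_apply (measurable_cellShift σ) hA]
  have hsum : ∀ B : Set ℝ,
      unitMeasure B = ∑ i, unitMeasure (cellIdx n ⁻¹' {i} ∩ B) := by
    intro B
    have h := sum_measure_preimage_singleton (μ := unitMeasure.restrict B) Finset.univ
      (f := cellIdx n) fun i _ => measurable_cellIdx n (measurableSet_singleton i)
    rw [Finset.coe_univ, Set.preimage_univ, Measure.restrict_apply_univ] at h
    rw [← h]
    exact Finset.sum_congr rfl fun i _ =>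
      Measure.restrict_apply (measurable_cellIdx n (measurableSet_singleton i))
  rw [hsum, hsum A, ← Equiv.sum_comp σ fun i => unitMeasure (cellIdx n ⁻¹' {i} ∩ A)]
  refine Finset.sum_congr rfl fun i _ => ?_
  have hshift : cellIdx n ⁻¹' {i} ∩ cellShift n σ ⁻¹' A =
      cellIdx n ⁻¹' {i} ∩ (fun t => t + ((σ i : ℝ) - i) / (n + 1)) ⁻¹' A := by
    ext t
    simp only [Set.mem_inter_iff, Set.mem_preimage, Set.mem_singleton_iff]
    constructor <;> rintro ⟨rfl, h⟩ <;> exact ⟨rfl, h⟩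
  have hIco : Set.Ico ((i : ℝ) / (n + 1)) ((i + 1) / (n + 1)) =
      (fun t => t + ((σ i : ℝ) - i) / (n + 1)) ⁻¹'
        Set.Ico ((σ i : ℝ) / (n + 1)) ((σ i + 1) / (n + 1)) := by
    ext t
    simp only [Set.mem_Ico, Set.mem_preimage, sub_div, add_div]
    constructor <;> rintro ⟨h1, h2⟩ <;> constructor <;> linarith
  rw [hshift, unitMeasure_inter_cell, unitMeasure_inter_cell, hIco, ← Set.preimage_inter,
    measure_preimage_add_right]

/-! ### Approximation of measure-preserving maps by permutations of cells -/

theorem integral_comp_fintype {X κ : Type*} [MeasurableSpace X] [Fintype κ] [MeasurableSpace κ]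
    [MeasurableSingletonClass κ] (ν : Measure X) [IsFiniteMeasure ν] {g : X → κ}
    (hg : Measurable g) (F : κ → ℝ) : ∫ x, F (g x) ∂ν = ∑ k, ν.real (g ⁻¹' {k}) * F k := by
  have hF : Measurable F := .of_discrete
  rw [← integral_map hg.aemeasurable hF.aestronglyMeasurable, integral_fintype .of_finite]
  simp [map_measureReal_apply hg (measurableSet_singleton _)]

/-- A linear cost is at most as large at some permutation as at a given doubly stochastic matrix. -/
theorem exists_perm_sum_le {ι : Type*} [Fintype ι] [DecidableEq ι] {M : Matrix ι ι ℝ}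
    (hM : M ∈ doublyStochastic ℝ ι) (c : ι → ι → ℝ) :
    ∃ σ : Equiv.Perm ι, ∑ i, c i (σ i) ≤ ∑ i, ∑ j, M i j * c i j := by
  -- By Birkhoff–von Neumann the cost of `M` is a weighted average of costs of permutations, so some
  -- permutation does not exceed it.
  obtain ⟨w, hw0, hw1, rfl⟩ := exists_eq_sum_perm_of_mem_doublyStochastic hM
  have h : ∑ i, ∑ j, (∑ σ, w σ • σ.permMatrix ℝ) i j * c i j = ∑ σ, w σ * ∑ i, c i (σ i) := by
    simp only [Matrix.sum_apply, Matrix.smul_apply, Finset.sum_mul, Equiv.Perm.permMatrix,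
      PEquiv.toMatrix_apply, Equiv.toPEquiv_apply, Finset.mul_sum]
    rw [Finset.sum_congr rfl fun i _ => Finset.sum_comm, Finset.sum_comm]
    refine Finset.sum_congr rfl fun σ _ => Finset.sum_congr rfl fun i _ => ?_
    simp
  rw [h]
  by_contra! hlt
  set b := ∑ σ, w σ * ∑ i, c i (σ i)
  have h1 : ∑ σ, w σ * b < ∑ σ, w σ * ∑ i, c i (σ i) := by
    refine Finset.sum_lt_sum (fun σ _ => mul_le_mul_of_nonneg_left (hlt σ).le (hw0 σ)) ?_
    obtain ⟨σ, hσ⟩ : ∃ σ, w σ ≠ 0 := by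
      by_contra! h0
      simp [h0] at hw1
    exact ⟨σ, Finset.mem_univ _,
      mul_lt_mul_of_pos_left (hlt σ) (lt_of_le_of_ne (hw0 σ) hσ.symm)⟩
  rw [← Finset.sum_mul, hw1, one_mul] at h1
  exact lt_irrefl _ h1

theorem integrable_of_measurable_of_mem {X : Type*} [MeasurableSpace X] {ν : Measure X}
    [IsFiniteMeasure ν] {f : X → ℝ} (hf : Measurable f) {C : ℝ} (hb : ∀ᵐ x ∂ν, |f x| ≤ C) :
    Integrable f ν :=
  Integrable.of_bound hf.aestronglyMeasurable C hb

/-- A measure-preserving map of `[0, 1)` is close to a permutation of cells as soon as it is close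
to a function that is constant on the cells. -/
theorem exists_perm_integral_le {w : ℝ → ℝ} (hw : MeasurePreserving w unitMeasure unitMeasure)
    (h : Fin (n + 1) → ℝ) :
    ∃ ρ : Equiv.Perm (Fin (n + 1)), ∫ t, |w t - cellShift n ρ t| ∂unitMeasure ≤
      2 * ∫ t, |w t - h (cellIdx n t)| ∂unitMeasure + 2 / (n + 1) := by
  have hn : (0 : ℝ) < n + 1 := by positivity
  have hg : Measurable fun t => (cellIdx n t, cellIdx n (w t)) :=
    (measurable_cellIdx n).prodMk ((measurable_cellIdx n).comp hw.measurable)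
  have hwm : ∀ᵐ t ∂unitMeasure, w t ∈ Set.Ico (0 : ℝ) 1 :=
    hw.quasiMeasurePreserving.ae ae_unitMeasure_mem
  -- `M i j` is the conditional probability that `w` sends a point of cell `i` into cell `j`. Rows
  -- sum to `1` because the cells have equal measure, columns because `w` preserves the measure.
  let M : Matrix (Fin (n + 1)) (Fin (n + 1)) ℝ := fun i j => (n + 1) *
    unitMeasure.real ((fun t => (cellIdx n t, cellIdx n (w t))) ⁻¹' {(i, j)})
  have hM : M ∈ doublyStochastic ℝ (Fin (n + 1)) := by
    rw [mem_doublyStochastic_iff_sum]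
    refine ⟨fun i j => by positivity, fun i => ?_, fun j => ?_⟩
    · have h1 := integral_comp_fintype unitMeasure hg fun k => if k.1 = i then (1 : ℝ) else 0
      have h2 := integral_comp_fintype unitMeasure (measurable_cellIdx n)
        fun k => if k = i then (1 : ℝ) else 0
      dsimp only at h1
      rw [h2, Fintype.sum_prod_type, Finset.sum_eq_single i, Finset.sum_eq_single i] at h1
      · simp only [if_true, mul_one, unitMeasure_cell] at h1
        simp only [M]
        rw [← Finset.mul_sum, ← h1]
        field_simp
      all_goals simp +contextual
    · have h1 := integral_comp_fintype unitMeasure hg fun k => if k.2 = j then (1 : ℝ) else 0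
      have h2 := integral_comp_fintype unitMeasure ((measurable_cellIdx n).comp hw.measurable)
        fun k => if k = j then (1 : ℝ) else 0
      dsimp only [Function.comp] at h1 h2
      rw [h2, Fintype.sum_prod_type_right, Finset.sum_eq_single j, Finset.sum_eq_single j] at h1
      · rw [Set.preimage_comp, measureReal_def, hw.measure_preimage
            (measurable_cellIdx n (measurableSet_singleton j)).nullMeasurableSet,
          ← measureReal_def] at h1
        simp only [if_true, mul_one, unitMeasure_cell] at h1
        simp only [M]
        rw [← Finset.mul_sum, ← h1]
        field_simp
      all_goals simp +contextual
  -- The cost compares `h` on cell `i` with the left endpoint of cell `j`. Replacing a point by the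
  -- left endpoint of its cell costs at most `1 / (n + 1)`, once for `w` in `i1` and once for
  -- `cellShift n ρ` in `i2`.
  obtain ⟨ρ, hρ⟩ := exists_perm_sum_le hM fun i j => |h i - (j : ℝ) / (n + 1)|
  refine ⟨ρ, ?_⟩
  have e1 : ∑ i, ∑ j, M i j * |h i - (j : ℝ) / (n + 1)| =
      (n + 1) * ∫ t, |h (cellIdx n t) - (cellIdx n (w t) : ℝ) / (n + 1)| ∂unitMeasure := by
    rw [integral_comp_fintype unitMeasure hg fun k => |h k.1 - (k.2 : ℝ) / (n + 1)|,
      Fintype.sum_prod_type, Finset.mul_sum]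
    refine Finset.sum_congr rfl fun i _ => ?_
    rw [Finset.mul_sum]
    exact Finset.sum_congr rfl fun j _ => mul_assoc _ _ _
  have e2 : ∑ i, |h i - (ρ i : ℝ) / (n + 1)| =
      (n + 1) * ∫ t, |h (cellIdx n t) - (ρ (cellIdx n t) : ℝ) / (n + 1)| ∂unitMeasure := by
    rw [integral_comp_fintype unitMeasure (measurable_cellIdx n)
      fun k => |h k - (ρ k : ℝ) / (n + 1)|, Finset.mul_sum]
    refine Finset.sum_congr rfl fun i _ => ?_
    rw [unitMeasure_cell]
    field_simp
  rw [e1, e2] at hρ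
  have hρ' := le_of_mul_le_mul_left hρ hn
  have hbd : ∀ F : Fin (n + 1) → Fin (n + 1) → ℝ,
      Integrable (fun t => F (cellIdx n t) (cellIdx n (w t))) unitMeasure := by
    intro F
    have hF : Measurable fun k : Fin (n + 1) × Fin (n + 1) => F k.1 k.2 := .of_discrete
    have : Integrable (fun k : Fin (n + 1) × Fin (n + 1) => F k.1 k.2)
      (unitMeasure.map fun t => (cellIdx n t, cellIdx n (w t))) := .of_finite
    exact this.comp_measurable hg
  have hwi : Integrable w unitMeasure :=
    integrable_of_measurable_of_mem hw.measurable (C := 1) <| hwm.mono fun t ht => by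
      rw [abs_le]; constructor <;> linarith [ht.1, ht.2]
  have hci : Integrable (cellShift n ρ) unitMeasure :=
    integrable_of_measurable_of_mem (measurable_cellShift ρ) (C := 1) <|
      ae_unitMeasure_mem.mono fun t ht => by
        have := cellShift_mem ρ ht
        rw [abs_le]; constructor <;> linarith [this.1, this.2]
  have hhi : Integrable (fun t => |w t - h (cellIdx n t)|) unitMeasure :=
    (hwi.sub (hbd fun i _ => h i)).abs
  have i1 : ∫ t, |h (cellIdx n t) - (cellIdx n (w t) : ℝ) / (n + 1)| ∂unitMeasure ≤
      ∫ t, (|w t - h (cellIdx n t)| + 1 / (n + 1)) ∂unitMeasure := by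
    refine integral_mono_ae (hbd fun i j => |h i - (j : ℝ) / (n + 1)|)
      (hhi.add (integrable_const _)) ?_
    filter_upwards [hwm] with t ht
    have := abs_sub_cellIdx_div_le (n := n) ht
    calc |h (cellIdx n t) - (cellIdx n (w t) : ℝ) / (n + 1)|
        = |-(w t - h (cellIdx n t)) + (w t - (cellIdx n (w t) : ℝ) / (n + 1))| := by ring_nf
      _ ≤ _ := (abs_add_le _ _).trans (by rw [abs_neg]; gcongr)
  have hb2 : Integrable (fun t => |h (cellIdx n t) - (ρ (cellIdx n t) : ℝ) / (n + 1)|)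
      unitMeasure := hbd fun i _ => |h i - (ρ i : ℝ) / (n + 1)|
  have hb3 : Integrable (fun t => |h (cellIdx n t) - (ρ (cellIdx n t) : ℝ) / (n + 1)| +
      1 / ((n : ℝ) + 1)) unitMeasure := hb2.add (integrable_const _)
  have i2 : ∫ t, |w t - cellShift n ρ t| ∂unitMeasure ≤
      ∫ t, (|w t - h (cellIdx n t)| + (|h (cellIdx n t) - (ρ (cellIdx n t) : ℝ) / (n + 1)| +
        1 / (n + 1))) ∂unitMeasure := by
    refine integral_mono_ae (hwi.sub hci).abs (hhi.add hb3) ?_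
    filter_upwards [ae_unitMeasure_mem] with t ht
    have := abs_sub_cellIdx_div_le (n := n) (cellShift_mem ρ ht)
    rw [cellIdx_cellShift ρ ht, abs_sub_comm] at this
    calc |w t - cellShift n ρ t|
        = |(w t - h (cellIdx n t)) + ((h (cellIdx n t) - (ρ (cellIdx n t) : ℝ) / (n + 1)) +
          ((ρ (cellIdx n t) : ℝ) / (n + 1) - cellShift n ρ t))| := by ring_nf
      _ ≤ _ := (abs_add_le _ _).trans (add_le_add le_rfl ((abs_add_le _ _).trans (by gcongr)))
  rw [integral_add hhi (integrable_const _)] at i1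
  rw [integral_add hhi hb3, integral_add hb2 (integrable_const _)] at i2
  simp only [integral_const, probReal_univ, one_smul] at i1 i2
  have : (2 : ℝ) / (n + 1) = 1 / (n + 1) + 1 / (n + 1) := by ring
  linarith

/-- Every measure-preserving map of `[0, 1)` is approximated by permutations of cells. -/
theorem eventually_exists_perm_integral_lt {w : ℝ → ℝ}
    (hw : MeasurePreserving w unitMeasure unitMeasure) {ε : ℝ} (hε : 0 < ε) :
    ∀ᶠ n in atTop, ∃ ρ : Equiv.Perm (Fin (n + 1)),
      ∫ t, |w t - cellShift n ρ t| ∂unitMeasure < ε := by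
  have hwm : ∀ᵐ t ∂unitMeasure, w t ∈ Set.Ico (0 : ℝ) 1 :=
    hw.quasiMeasurePreserving.ae ae_unitMeasure_mem
  have hwi : Integrable w unitMeasure :=
    integrable_of_measurable_of_mem hw.measurable (C := 1) <| hwm.mono fun t ht => by
      rw [abs_le]; constructor <;> linarith [ht.1, ht.2]
  -- The budget: `ε / 8` for the continuous approximation and `ε / 8` for sampling it at left
  -- endpoints, both doubled, plus `2 / (n + 1) < 2 * (ε / 8)`; in all less than `6 * (ε / 8)`.
  obtain ⟨h, hc, hle, hcont, hint⟩ :=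
    hwi.exists_hasCompactSupport_integral_sub_le (ε := ε / 8) (by positivity)
  have hsub : Integrable (fun t => ‖w t - h t‖) unitMeasure := (hwi.sub hint).norm
  have huc := hcont.uniformContinuous_of_tendsto_cocompact hc.is_zero_at_infty
  rw [Metric.uniformContinuous_iff] at huc
  obtain ⟨δ, hδ, hu⟩ := huc (ε / 8) (by positivity)
  have t1 : Tendsto (fun n : ℕ => (1 : ℝ) / (n + 1)) atTop (𝓝 0) :=
    tendsto_one_div_add_atTop_nhds_zero_nat
  filter_upwards [t1.eventually (gt_mem_nhds hδ),
    t1.eventually (gt_mem_nhds (show 0 < ε / 8 by positivity))] with n h1 h2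
  obtain ⟨ρ, hρ⟩ := exists_perm_integral_le hw fun i : Fin (n + 1) => h ((i : ℝ) / (n + 1))
  refine ⟨ρ, hρ.trans_lt ?_⟩
  have i1 : ∫ t, |w t - h ((cellIdx n t : ℝ) / (n + 1))| ∂unitMeasure ≤
      ∫ t, (‖w t - h t‖ + ε / 8) ∂unitMeasure := by
    refine integral_mono_of_nonneg (.of_forall fun _ => abs_nonneg _)
      (hsub.add (integrable_const _)) ?_
    filter_upwards [ae_unitMeasure_mem] with t ht
    have h3 := hu ((abs_sub_cellIdx_div_le (n := n) ht).trans_lt h1)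
    rw [Real.dist_eq] at h3
    calc |w t - h ((cellIdx n t : ℝ) / (n + 1))|
        = |(w t - h t) + (h t - h ((cellIdx n t : ℝ) / (n + 1)))| := by ring_nf
      _ ≤ _ := (abs_add_le _ _).trans (add_le_add le_rfl h3.le)
  rw [integral_add hsub (integrable_const _)] at i1
  simp only [integral_const, probReal_univ, one_smul] at i1
  have : (2 : ℝ) / (n + 1) = 2 * (1 / (n + 1)) := by ring
  linarith

/-- A permutation that moves few cells is close to the identity. -/
theorem integral_sub_cellShift_sq_le (σ : Equiv.Perm (Fin (n + 1))) :
    ∫ t, (cellShift n σ t - t) ^ 2 ∂unitMeasure ≤ (hammingCount σ 1 : ℝ) / (n + 1) := by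
  have hF := integral_comp_fintype unitMeasure (measurable_cellIdx n)
    fun i => if σ i ≠ i then (1 : ℝ) else 0
  have h2 : ∑ i, unitMeasure.real (cellIdx n ⁻¹' {i}) * (if σ i ≠ i then (1 : ℝ) else 0) =
      (hammingCount σ 1 : ℝ) / (n + 1) := by
    simp only [unitMeasure_cell, hammingCount, ← Finset.mul_sum, Finset.sum_boole]
    simp only [Equiv.Perm.one_apply]
    rw [mul_comm, mul_one_div]
    congr!
  rw [← h2, ← hF]
  refine integral_mono_of_nonneg (.of_forall fun _ => sq_nonneg _) ?_ ?_
  · have : Integrable (fun i => if σ i ≠ i then (1 : ℝ) else 0)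
      (unitMeasure.map (cellIdx n)) := .of_finite
    exact this.comp_measurable (measurable_cellIdx n)
  · filter_upwards [ae_unitMeasure_mem] with t ht
    have h3 := cellShift_mem σ ht
    by_cases hσ : σ (cellIdx n t) = cellIdx n t
    · simp [hσ, cellShift]
    · simp only [ne_eq, hσ, not_false_eq_true, if_true]
      rw [sq_le_one_iff_abs_le_one, abs_le]
      constructor <;> linarith [h3.1, h3.2, ht.1, ht.2]

end Interval

/-! ### Coordinates on a non-atomic standard probability space -/

section Coordinate

open ProbabilityTheory

/-- The jump of the distribution function at a point is the mass of that point. -/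
theorem continuous_cdf (ν : Measure ℝ) [IsProbabilityMeasure ν] [NullSingletonClass ν] :
    Continuous (cdf ν) := by
  rw [continuous_iff_continuousAt]
  intro a
  rw [(cdf ν).mono.continuousAt_iff_leftLim_eq_rightLim, (cdf ν).rightLim_eq]
  refine le_antisymm ((cdf ν).mono.leftLim_le le_rfl) ?_
  have h := (cdf ν).measure_singleton a
  rw [measure_cdf, measure_singleton, eq_comm, ENNReal.ofReal_eq_zero] at h
  linarith

theorem exists_cdf_eq (ν : Measure ℝ) [IsProbabilityMeasure ν] [NullSingletonClass ν] {a : ℝ}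
    (ha : a ∈ Set.Ioo (0 : ℝ) 1) : ∃ s, cdf ν s = a :=
  mem_range_of_exists_le_of_exists_ge (continuous_cdf ν)
    ((((tendsto_cdf_atBot ν).eventually (gt_mem_nhds ha.1)).exists).imp fun _ h => h.le)
    ((((tendsto_cdf_atTop ν).eventually (lt_mem_nhds ha.2)).exists).imp fun _ h => h.le)

/-- The probability integral transform. -/
theorem measurePreserving_cdf (ν : Measure ℝ) [IsProbabilityMeasure ν] [NullSingletonClass ν] :
    MeasurePreserving (cdf ν) ν unitMeasure := by
  have hmeas : Measurable (cdf ν) := (monotone_cdf ν).measurable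
  refine ⟨hmeas, ?_⟩
  have := Measure.isProbabilityMeasure_map (μ := ν) hmeas.aemeasurable
  refine Measure.ext_of_Iic _ _ fun a => ?_
  rw [Measure.map_apply hmeas measurableSet_Iic, unitMeasure,
    Measure.restrict_apply measurableSet_Iic]
  have hle : ∀ s, ν (cdf ν ⁻¹' Set.Iic (cdf ν s)) ≥ ENNReal.ofReal (cdf ν s) := fun s => by
    rw [ofReal_cdf]
    exact measure_mono fun x hx => monotone_cdf ν hx
  have hge : ∀ b s, b < cdf ν s → ν (cdf ν ⁻¹' Set.Iic b) ≤ ENNReal.ofReal (cdf ν s) := by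
    intro b s hbs
    rw [ofReal_cdf]
    exact measure_mono fun x hx => le_of_lt <| (monotone_cdf ν).reflect_lt (lt_of_le_of_lt hx hbs)
  rcases lt_or_ge a 0 with ha | ha
  · have h1 : cdf ν ⁻¹' Set.Iic a = ∅ := Set.eq_empty_of_forall_notMem fun x hx =>
      absurd (cdf_nonneg ν x) (not_le.mpr (lt_of_le_of_lt hx ha))
    have h2 : Set.Iic a ∩ Set.Ico 0 1 = ∅ := Set.eq_empty_of_forall_notMem fun x hx =>
      absurd (hx.2.1) (not_le.mpr (lt_of_le_of_lt hx.1 ha))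
    simp [h1, h2]
  rcases le_or_gt 1 a with ha1 | ha1
  · have h1 : cdf ν ⁻¹' Set.Iic a = Set.univ := Set.eq_univ_of_forall fun x =>
      (cdf_le_one ν x).trans ha1
    have h2 : Set.Iic a ∩ Set.Ico 0 1 = Set.Ico 0 1 :=
      Set.inter_eq_right.mpr fun x hx => hx.2.le.trans ha1
    simp [h1, h2]
  have h2 : Set.Iic a ∩ Set.Ico 0 1 = Set.Icc 0 a := by
    ext x
    simp only [Set.mem_inter_iff, Set.mem_Iic, Set.mem_Ico, Set.mem_Icc]
    constructor
    · rintro ⟨h1, h2, -⟩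
      exact ⟨h2, h1⟩
    · rintro ⟨h1, h2⟩
      exact ⟨h2, h1, h2.trans_lt ha1⟩
  rw [h2, Real.volume_Icc, sub_zero]
  refine le_antisymm ?_ ?_
  -- Flat pieces of the distribution function block a direct computation at level `a`, so the upper
  -- bound is taken at attained values `b > a` and `b` decreases to `a`.
  · refine ge_of_tendsto (x := 𝓝[>] a)
      (ENNReal.continuous_ofReal.continuousAt.tendsto.mono_left nhdsWithin_le_nhds) ?_
    filter_upwards [Ioo_mem_nhdsGT ha1] with b hb
    obtain ⟨s, rfl⟩ := exists_cdf_eq ν ⟨ha.trans_lt hb.1, hb.2⟩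
    exact hge a s hb.1
  · rcases ha.eq_or_lt with rfl | ha0
    · simp
    · obtain ⟨s, rfl⟩ := exists_cdf_eq ν ⟨ha0, ha1⟩
      exact hle s

variable {X : Type u} [MeasurableSpace X]

/-- An isomorphism modulo null sets between `(X, μ)` and `[0, 1)` with Lebesgue measure, which is
defined off a null set that is invariant under rational translations. -/
structure UnitCoordinate (μ : Measure X) where
  toReal : X → ℝ
  ofReal : ℝ → X
  domain : Set ℝ
  measurable_ofReal : Measurable ofReal
  measurableSet_domain : MeasurableSet domain
  measurePreserving : MeasurePreserving toReal μ unitMeasure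
  domain_subset : domain ⊆ Set.Ico 0 1
  ae_mem_domain : ∀ᵐ t ∂unitMeasure, t ∈ domain
  ofReal_toReal : ∀ x, toReal x ∈ domain → ofReal (toReal x) = x
  toReal_ofReal : ∀ t ∈ domain, toReal (ofReal t) = t
  add_mem_domain : ∀ t ∈ domain, ∀ q : ℚ, t + q ∈ Set.Ico (0 : ℝ) 1 → t + q ∈ domain

theorem not_countable_of_nullSingletonClass (μ : Measure X) [IsProbabilityMeasure μ]
    [NullSingletonClass μ] : ¬ Countable X := by
  intro h
  have := (Set.countable_univ (α := X)).measure_zero μ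
  simp at this

/-- An uncountable standard Borel space is isomorphic to the line, and the distribution function `F`
of the transported measure carries it to Lebesgue measure. Two points share a value of `F` only
across a flat piece, which contains a rational, so removing the countable set of values of `F` at
rationals makes the coordinate injective. A measurable injection between standard Borel spaces is a
measurable embedding, which gives the measurable inverse. -/
theorem nonempty_unitCoordinate [StandardBorelSpace X] (μ : Measure X) [IsProbabilityMeasure μ]
    [NullSingletonClass μ] : Nonempty (UnitCoordinate μ) := by
  have hX := not_countable_of_nullSingletonClass μ
  have hXne : Nonempty X := nonempty_of_isProbabilityMeasure μ
  let e : X ≃ᵐ ℝ := PolishSpace.measurableEquivOfNotCountable hX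
    (not_countable_iff.mpr inferInstance)
  let ν := μ.map e
  have hν : IsProbabilityMeasure ν := Measure.isProbabilityMeasure_map e.measurable.aemeasurable
  have hν' : NullSingletonClass ν := ⟨fun t => by
    rw [e.map_apply, ← e.image_symm, Set.image_singleton, measure_singleton]⟩
  let F := cdf ν
  have hφ : MeasurePreserving (fun x => F (e x)) μ unitMeasure :=
    (measurePreserving_cdf ν).comp ⟨e.measurable, rfl⟩
  -- All rational translates of the bad values are removed, so that the complement is stable under
  -- rational translations. The rationals are removed as well because `0` need not be a value of
  -- `F`.
  let Q : Set ℝ := Set.range (fun p : ℚ × ℚ => F p.1 + p.2) ∪ Set.range (fun q : ℚ => (q : ℝ))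
  have hQ : Q.Countable := (Set.countable_range _).union (Set.countable_range _)
  have hQadd : ∀ t : ℝ, ∀ q : ℚ, t + q ∈ Q → t ∈ Q := by
    rintro t q (⟨⟨p, r⟩, h⟩ | ⟨r, h⟩)
    · refine Or.inl ⟨⟨p, r - q⟩, ?_⟩
      simp only [Rat.cast_sub] at h ⊢
      linarith
    · refine Or.inr ⟨r - q, ?_⟩
      simp only [Rat.cast_sub] at h ⊢
      linarith
  let C : Set ℝ := Set.Ico 0 1 \ Q
  have hC : MeasurableSet C := measurableSet_Ico.diff hQ.measurableSet
  have hlt : ∀ x y, F (e x) ∈ C → F (e x) = F (e y) → ¬ e x < e y := by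
    intro x y hx hxy hlt
    obtain ⟨q, h1, h2⟩ := exists_rat_btwn hlt
    refine hx.2 (Or.inl ⟨⟨q, 0⟩, ?_⟩)
    have h3 := F.mono h1.le
    have h4 := F.mono h2.le
    simp only [Rat.cast_zero, add_zero]
    linarith
  have hinj : ∀ x y, F (e x) ∈ C → F (e x) = F (e y) → x = y := by
    intro x y hx hxy
    refine e.injective (le_antisymm ?_ ?_)
    · exact not_lt.mp (hlt y x (hxy ▸ hx) hxy.symm)
    · exact not_lt.mp (hlt x y hx hxy)
  let S : Set X := (fun x => F (e x)) ⁻¹' C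
  have hS : MeasurableSet S := hφ.measurable hC
  have hSB : StandardBorelSpace S := hS.standardBorel
  have hemb : MeasurableEmbedding fun x : S => F (e x) :=
    (hφ.measurable.comp measurable_subtype_coe).measurableEmbedding fun x y hxy =>
      Subtype.ext (hinj x y x.2 hxy)
  obtain ⟨ψ, hψ, hψe⟩ := hemb.exists_measurable_extend (g := fun x : S => (x : X))
    measurable_subtype_coe fun _ => hXne
  have hψφ : ∀ x, F (e x) ∈ C → ψ (F (e x)) = x := fun x hx => congrFun hψe ⟨x, hx⟩
  refine ⟨⟨fun x => F (e x), ψ, C, hψ, hC, hφ, Set.sdiff_subset, ?_, hψφ, ?_, ?_⟩⟩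
  · have hQ0 : unitMeasure Q = 0 := by
      refine le_antisymm ?_ zero_le
      exact (Measure.restrict_apply_le _ _).trans (hQ.measure_zero _).le
    filter_upwards [ae_unitMeasure_mem, measure_eq_zero_iff_ae_notMem.mp hQ0] with t h1 h2
    exact ⟨h1, h2⟩
  · intro t ht
    have h0 : t ≠ 0 := by
      rintro rfl
      exact ht.2 (Or.inr ⟨0, by simp⟩)
    obtain ⟨s, rfl⟩ := exists_cdf_eq ν ⟨lt_of_le_of_ne ht.1.1 h0.symm, ht.1.2⟩
    have h := hψφ (e.symm s)
    simp only [e.apply_symm_apply] at h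
    change F (e (ψ (F s))) = F s
    rw [h ht, e.apply_symm_apply]
  · intro t ht q hq
    exact ⟨hq, fun h => ht.2 (hQadd t q h)⟩

namespace UnitCoordinate

variable {μ : Measure X} (c : UnitCoordinate μ) {n : ℕ}

theorem ae_toReal_mem : ∀ᵐ x ∂μ, c.toReal x ∈ c.domain :=
  c.measurePreserving.quasiMeasurePreserving.ae c.ae_mem_domain

theorem measurePreserving_ofReal : MeasurePreserving c.ofReal unitMeasure μ := by
  refine ⟨c.measurable_ofReal, ?_⟩
  rw [← c.measurePreserving.map_eq,
    Measure.map_map c.measurable_ofReal c.measurePreserving.measurable]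
  have h : c.ofReal ∘ c.toReal =ᵐ[μ] id := c.ae_toReal_mem.mono c.ofReal_toReal
  rw [Measure.map_congr h, Measure.map_id]

/-- The displacement is a multiple of `1 / (n + 1)`, hence rational. Thus permutations of cells act
on `X` by genuine bijections, with composition exact rather than modulo null sets. -/
theorem cellShift_mem_domain (σ : Equiv.Perm (Fin (n + 1))) {t : ℝ} (ht : t ∈ c.domain) :
    cellShift n σ t ∈ c.domain := by
  have h := c.add_mem_domain t ht (((σ (cellIdx n t) : ℕ) - (cellIdx n t : ℕ)) / (n + 1))
  push_cast at h
  exact h (cellShift_mem σ (c.domain_subset ht))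

open Classical in
/-- The map of `X` that permutes the cells of `[0, 1)`, read in the coordinate. -/
def cellMap (σ : Equiv.Perm (Fin (n + 1))) (x : X) : X :=
  if c.toReal x ∈ c.domain then c.ofReal (cellShift n σ (c.toReal x)) else x

theorem toReal_cellMap (σ : Equiv.Perm (Fin (n + 1))) {x : X} (hx : c.toReal x ∈ c.domain) :
    c.toReal (c.cellMap σ x) = cellShift n σ (c.toReal x) := by
  rw [cellMap, if_pos hx, c.toReal_ofReal _ (c.cellShift_mem_domain σ hx)]

theorem cellMap_mul (σ τ : Equiv.Perm (Fin (n + 1))) (x : X) :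
    c.cellMap (σ * τ) x = c.cellMap σ (c.cellMap τ x) := by
  by_cases hx : c.toReal x ∈ c.domain
  · have hx' : c.toReal (c.cellMap τ x) ∈ c.domain := by
      rw [c.toReal_cellMap τ hx]
      exact c.cellShift_mem_domain τ hx
    rw [cellMap, if_pos hx, cellMap, if_pos hx', c.toReal_cellMap τ hx,
      cellShift_mul _ _ (c.domain_subset hx)]
  · have hx' : c.cellMap τ x = x := if_neg hx
    rw [hx', cellMap, cellMap, if_neg hx, if_neg hx]

theorem cellMap_one (x : X) : c.cellMap (1 : Equiv.Perm (Fin (n + 1))) x = x := by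
  by_cases hx : c.toReal x ∈ c.domain
  · rw [cellMap, if_pos hx, cellShift_one, c.ofReal_toReal x hx]
  · exact if_neg hx

theorem measurable_cellMap (σ : Equiv.Perm (Fin (n + 1))) : Measurable (c.cellMap σ) :=
  Measurable.ite (c.measurePreserving.measurable c.measurableSet_domain)
    (c.measurable_ofReal.comp ((measurable_cellShift σ).comp c.measurePreserving.measurable))
    measurable_id

theorem measurePreserving_cellMap (σ : Equiv.Perm (Fin (n + 1))) :
    MeasurePreserving (c.cellMap σ) μ μ := by
  have h := c.measurePreserving_ofReal.comp
    ((measurePreserving_cellShift σ).comp c.measurePreserving)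
  refine ⟨c.measurable_cellMap σ, ?_⟩
  exact (Measure.map_congr (c.ae_toReal_mem.mono fun x hx => if_pos hx)).trans h.map_eq

/-- Permutations of cells as automorphisms of `(X, μ)`. -/
def cellAut (n : ℕ) : Equiv.Perm (Fin (n + 1)) →* BorelAut μ where
  toFun σ := ⟨⟨⟨c.cellMap σ, c.cellMap σ⁻¹,
      fun x => by rw [← c.cellMap_mul, inv_mul_cancel, c.cellMap_one],
      fun x => by rw [← c.cellMap_mul, mul_inv_cancel, c.cellMap_one]⟩,
    c.measurable_cellMap σ, c.measurable_cellMap σ⁻¹⟩, c.measurePreserving_cellMap σ⟩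
  map_one' := Subtype.ext (MeasurableEquiv.ext (funext c.cellMap_one))
  map_mul' σ τ := Subtype.ext (MeasurableEquiv.ext (funext (c.cellMap_mul σ τ)))

theorem toReal_cellAut_symm (σ : Equiv.Perm (Fin (n + 1))) {x : X} (hx : c.toReal x ∈ c.domain) :
    c.toReal ((c.cellAut n σ).1.symm x) = cellShift n σ⁻¹ (c.toReal x) :=
  c.toReal_cellMap σ⁻¹ hx

end UnitCoordinate

end Coordinate

/-! ### The strong topology on `Aut (X, μ)` -/

section StrongTopology

variable {X : Type u} [MeasurableSpace X] {μ : Measure X}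

theorem MeasureAut.Φ_mk (T : BorelAut μ) (f : Lp ℂ 2 μ) :
    MeasureAut.Φ μ (QuotientGroup.mk T : BorelAut μ ⧸ BorelAut.null μ) f =
      BorelAut.unitaryOp T f := rfl

theorem MeasureAut.continuous_Φ_apply (f : Lp ℂ 2 μ) :
    Continuous fun T : MeasureAut μ => MeasureAut.Φ μ T f :=
  (continuous_apply f).comp continuous_induced_dom

theorem MeasureAut.continuous_iff {Z : Type*} [TopologicalSpace Z] {g : Z → MeasureAut μ} :
    Continuous g ↔ ∀ f : Lp ℂ 2 μ, Continuous fun z => MeasureAut.Φ μ (g z) f := by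
  rw [continuous_induced_rng, continuous_pi_iff]
  rfl

theorem MeasureAut.Φ_mul_apply (S T : MeasureAut μ) (f : Lp ℂ 2 μ) :
    MeasureAut.Φ μ (S * T) f = MeasureAut.Φ μ S (MeasureAut.Φ μ T f) := by
  rw [map_mul]
  rfl

theorem MeasureAut.Φ_self_inv_apply (S : MeasureAut μ) (f : Lp ℂ 2 μ) :
    MeasureAut.Φ μ S (MeasureAut.Φ μ S⁻¹ f) = f := by
  rw [← Φ_mul_apply, mul_inv_cancel, map_one]
  rfl

instance MeasureAut.isTopologicalGroup : IsTopologicalGroup (MeasureAut μ) where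
  continuous_mul := by
    rw [MeasureAut.continuous_iff]
    refine fun f => continuous_iff_continuousAt.mpr fun p => ?_
    rw [ContinuousAt, tendsto_iff_dist_tendsto_zero]
    have h1 : Tendsto (fun q : MeasureAut μ × MeasureAut μ =>
        dist (MeasureAut.Φ μ q.2 f) (MeasureAut.Φ μ p.2 f) +
          dist (MeasureAut.Φ μ q.1 (MeasureAut.Φ μ p.2 f))
            (MeasureAut.Φ μ p.1 (MeasureAut.Φ μ p.2 f))) (𝓝 p) (𝓝 (0 + 0)) :=
      (tendsto_iff_dist_tendsto_zero.mp
        (((MeasureAut.continuous_Φ_apply f).comp continuous_snd).tendsto p)).add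
      (tendsto_iff_dist_tendsto_zero.mp
        (((MeasureAut.continuous_Φ_apply (MeasureAut.Φ μ p.2 f)).comp continuous_fst).tendsto p))
    rw [add_zero] at h1
    refine squeeze_zero (fun _ => dist_nonneg) (fun q => ?_) h1
    rw [MeasureAut.Φ_mul_apply, MeasureAut.Φ_mul_apply]
    refine (dist_triangle _ (MeasureAut.Φ μ q.1 (MeasureAut.Φ μ p.2 f)) _).trans ?_
    rw [LinearIsometryEquiv.dist_map]
  continuous_inv := by
    rw [MeasureAut.continuous_iff]
    refine fun f => continuous_iff_continuousAt.mpr fun p => ?_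
    rw [ContinuousAt, tendsto_iff_dist_tendsto_zero]
    -- Since `Φ q` is an isometry, the distance from `Φ q⁻¹ f` to `Φ p⁻¹ f` equals that from `f` to
    -- `Φ q (Φ p⁻¹ f)`, which tends to `0` as `q` tends to `p`.
    have h1 := tendsto_iff_dist_tendsto_zero.mp
      ((MeasureAut.continuous_Φ_apply (MeasureAut.Φ μ p⁻¹ f)).tendsto p)
    refine h1.congr fun q => ?_
    have h2 := LinearIsometryEquiv.dist_map (MeasureAut.Φ μ q) (MeasureAut.Φ μ q⁻¹ f)
      (MeasureAut.Φ μ p⁻¹ f)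
    rw [MeasureAut.Φ_self_inv_apply] at h2
    rw [MeasureAut.Φ_self_inv_apply p, ← h2, dist_comm]

theorem Lp_two_norm_sq (f : Lp ℂ 2 μ) : ‖f‖ ^ 2 = ∫ x, ‖f x‖ ^ 2 ∂μ := by
  rw [Lp.norm_def, toReal_eLpNorm (Lp.aestronglyMeasurable f),
    lpNorm_eq_integral_norm_rpow_toReal (by simp) (by simp) (Lp.aestronglyMeasurable f)]
  have h : 0 ≤ ∫ x, ‖f x‖ ^ 2 ∂μ := integral_nonneg fun _ => sq_nonneg _
  simp only [ENNReal.toReal_ofNat, Real.rpow_two]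
  rw [← Real.rpow_natCast, ← Real.rpow_mul h]
  norm_num

namespace UnitCoordinate

variable (c : UnitCoordinate μ)

theorem ae_toReal_mem_Ico : ∀ᵐ x ∂μ, c.toReal x ∈ Set.Ico (0 : ℝ) 1 :=
  c.ae_toReal_mem.mono fun _ hx => c.domain_subset hx

variable [IsProbabilityMeasure μ]

theorem memLp_toReal : MemLp (fun x => (c.toReal x : ℂ)) 2 μ := by
  refine MemLp.of_bound
    (Complex.measurable_ofReal.comp c.measurePreserving.measurable).aestronglyMeasurable 1 ?_
  filter_upwards [c.ae_toReal_mem_Ico] with x hx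
  rw [Complex.norm_real, Real.norm_eq_abs, abs_le]
  constructor <;> linarith [hx.1, hx.2]

/-- The coordinate as an element of `L²`. -/
def vector : Lp ℂ 2 μ := c.memLp_toReal.toLp _

theorem unitaryOp_vector (T : BorelAut μ) :
    BorelAut.unitaryOp T c.vector =ᵐ[μ] fun x => (c.toReal (T.1.symm x) : ℂ) := by
  refine (BorelAut.coeFn_unitaryOp T _).trans ?_
  exact (T⁻¹).2.quasiMeasurePreserving.ae c.memLp_toReal.coeFn_toLp

theorem norm_unitaryOp_sub_sq (S T : BorelAut μ) :
    ‖BorelAut.unitaryOp S c.vector - BorelAut.unitaryOp T c.vector‖ ^ 2 =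
      ∫ x, (c.toReal (S.1.symm x) - c.toReal (T.1.symm x)) ^ 2 ∂μ := by
  rw [Lp_two_norm_sq]
  refine integral_congr_ae ?_
  filter_upwards [Lp.coeFn_sub (BorelAut.unitaryOp S c.vector) (BorelAut.unitaryOp T c.vector),
    c.unitaryOp_vector S, c.unitaryOp_vector T] with x h1 h2 h3
  rw [h1, Pi.sub_apply, h2, h3, ← Complex.ofReal_sub, Complex.norm_real, Real.norm_eq_abs, sq_abs]

/-- The action of `Aut (X, μ)` on `L²` is controlled by the action on the coordinate. -/
theorem exists_dist_Φ_le (f : Lp ℂ 2 μ) {ε : ℝ} (hε : 0 < ε) :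
    ∃ K : ℝ, 0 ≤ K ∧ ∀ S T : MeasureAut μ, dist (MeasureAut.Φ μ S f) (MeasureAut.Φ μ T f) ≤
      ε + K * dist (MeasureAut.Φ μ S c.vector) (MeasureAut.Φ μ T c.vector) := by
  have hf : MemLp (f ∘ c.ofReal) 2 unitMeasure :=
    (Lp.memLp f).comp_measurePreserving c.measurePreserving_ofReal
  -- In the coordinate, `f` is within `ε / 2` of a smooth compactly supported `g`. The approximation
  -- error enters twice, as both operators are isometries, and the Lipschitz constant of `g` serves
  -- as `K`.
  obtain ⟨g, hg1, hg2, hg3⟩ := hf.exist_eLpNorm_sub_le (by simp) (by simp) (half_pos hε)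
  obtain ⟨K, hK⟩ := hg2.lipschitzWith_of_hasCompactSupport hg1 (by simp)
  have hgL : MemLp g 2 unitMeasure := hg2.continuous.memLp_of_hasCompactSupport hg1
  have hgX : MemLp (g ∘ c.toReal) 2 μ := hgL.comp_measurePreserving c.measurePreserving
  have hclose : dist f (hgX.toLp _) ≤ ε / 2 := by
    rw [dist_eq_norm, Lp.norm_def]
    refine ENNReal.toReal_le_of_le_ofReal (half_pos hε).le (le_trans (le_of_eq ?_) hg3)
    rw [← eLpNorm_comp_measurePreserving (hf.sub hgL).aestronglyMeasurable c.measurePreserving]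
    refine eLpNorm_congr_ae ?_
    filter_upwards [Lp.coeFn_sub f (hgX.toLp _), hgX.coeFn_toLp, c.ae_toReal_mem] with x h1 h2 h3
    rw [h1, Pi.sub_apply, h2]
    simp [c.ofReal_toReal x h3]
  refine ⟨K, K.2, fun S T => ?_⟩
  obtain ⟨S, rfl⟩ := QuotientGroup.mk_surjective S
  obtain ⟨T, rfl⟩ := QuotientGroup.mk_surjective T
  simp only [MeasureAut.Φ_mk]
  have hlip : dist (BorelAut.unitaryOp S (hgX.toLp _)) (BorelAut.unitaryOp T (hgX.toLp _)) ≤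
      K * dist (BorelAut.unitaryOp S c.vector) (BorelAut.unitaryOp T c.vector) := by
    rw [dist_eq_norm, dist_eq_norm]
    refine Lp.norm_le_mul_norm_of_ae_le_mul ?_
    filter_upwards [Lp.coeFn_sub (BorelAut.unitaryOp S c.vector) (BorelAut.unitaryOp T c.vector),
      Lp.coeFn_sub (BorelAut.unitaryOp S (hgX.toLp _)) (BorelAut.unitaryOp T (hgX.toLp _)),
      c.unitaryOp_vector S, c.unitaryOp_vector T, BorelAut.coeFn_unitaryOp S (hgX.toLp _),
      BorelAut.coeFn_unitaryOp T (hgX.toLp _),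
      (S⁻¹).2.quasiMeasurePreserving.ae hgX.coeFn_toLp,
      (T⁻¹).2.quasiMeasurePreserving.ae hgX.coeFn_toLp] with x h1 h2 h3 h4 h5 h6 h7 h8
    have h7' : (hgX.toLp _) (S.1.symm x) = g (c.toReal (S.1.symm x)) := h7
    have h8' : (hgX.toLp _) (T.1.symm x) = g (c.toReal (T.1.symm x)) := h8
    rw [h1, h2, Pi.sub_apply, Pi.sub_apply, h3, h4, h5, h6, h7', h8', ← dist_eq_norm,
      ← Complex.ofReal_sub, Complex.norm_real, ← dist_eq_norm]
    exact hK.dist_le_mul _ _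
  have t1 := dist_triangle4 (BorelAut.unitaryOp S f) (BorelAut.unitaryOp S (hgX.toLp _))
    (BorelAut.unitaryOp T (hgX.toLp _)) (BorelAut.unitaryOp T f)
  rw [LinearIsometryEquiv.dist_map, LinearIsometryEquiv.dist_map, dist_comm (hgX.toLp _) f] at t1
  linarith

/-- By `exists_dist_Φ_le`, convergence on the coordinate vector forces convergence on every vector
of `L²`. -/
theorem isInducing_vector :
    IsInducing fun T : MeasureAut μ => MeasureAut.Φ μ T c.vector := by
  refine ⟨le_antisymm (continuous_iff_le_induced.mp (MeasureAut.continuous_Φ_apply _)) ?_⟩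
  let t' : TopologicalSpace (MeasureAut μ) :=
    TopologicalSpace.induced (fun T => MeasureAut.Φ μ T c.vector) inferInstance
  suffices h : @Continuous _ _ t' _ fun T : MeasureAut μ => (MeasureAut.Φ μ T : Lp ℂ 2 μ → Lp ℂ 2 μ)
    from continuous_iff_le_induced.mp h
  refine continuous_pi fun f => ?_
  refine continuous_iff_continuousAt.mpr fun T => ?_
  rw [ContinuousAt, Metric.tendsto_nhds]
  intro ε hε
  obtain ⟨K, hK, h⟩ := c.exists_dist_Φ_le f (half_pos hε)
  have hc : Tendsto (fun S => K * dist (MeasureAut.Φ μ S c.vector) (MeasureAut.Φ μ T c.vector))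
      (@nhds _ t' T) (𝓝 (K * 0)) := by
    refine Tendsto.const_mul _ (tendsto_iff_dist_tendsto_zero.mp ?_)
    exact (@continuous_induced_dom _ _ (fun T => MeasureAut.Φ μ T c.vector) _).continuousAt
  rw [mul_zero] at hc
  filter_upwards [hc.eventually (gt_mem_nhds (half_pos hε))] with S hS
  exact (h S T).trans_lt (by linarith)

/-- The coordinate is injective off a null set, so an automorphism is determined almost everywhere
by the coordinate of its inverse. -/
theorem injective_vector :
    Function.Injective fun T : MeasureAut μ => MeasureAut.Φ μ T c.vector := by
  intro S T hST
  obtain ⟨S, rfl⟩ := QuotientGroup.mk_surjective S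
  obtain ⟨T, rfl⟩ := QuotientGroup.mk_surjective T
  simp only [MeasureAut.Φ_mk] at hST
  refine QuotientGroup.eq.mpr ?_
  have h1 : ∀ᵐ x ∂μ, c.toReal (S.1.symm x) = c.toReal (T.1.symm x) := by
    filter_upwards [c.unitaryOp_vector S, c.unitaryOp_vector T] with x h1 h2
    rw [hST, h2] at h1
    exact_mod_cast h1.symm
  have h2 : ∀ᵐ x ∂μ, S.1.symm x = T.1.symm x := by
    filter_upwards [h1, (S⁻¹).2.quasiMeasurePreserving.ae c.ae_toReal_mem] with x h1 h2
    have h2' : c.toReal (S.1.symm x) ∈ c.domain := h2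
    rw [← c.ofReal_toReal _ h2', h1, c.ofReal_toReal _ (h1 ▸ h2')]
  change ∀ᵐ x ∂μ, S.1.symm (T.1 x) = x
  filter_upwards [T.2.quasiMeasurePreserving.ae h2] with x hx
  rw [hx, T.1.symm_apply_apply]

/-- The right-invariant metric on `Aut (X, μ)` given by the `L²` distance of the coordinates. -/
@[reducible]
def autMetric : MetricSpace (MeasureAut μ) :=
  MetricSpace.induced (fun T : MeasureAut μ => MeasureAut.Φ μ T⁻¹ c.vector)
    (c.injective_vector.comp inv_injective) inferInstance

theorem isCompatibleRightInvariant_autMetric : IsCompatibleRightInvariant c.autMetric where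
  compatible := (c.isInducing_vector.comp (Homeomorph.inv (MeasureAut μ)).isInducing).eq_induced
  -- The orbit map itself would give a left-invariant metric. With inverses, the right factor `R`
  -- becomes the isometry `Φ R⁻¹` on the left.
  right_invariant S T R := by
    change dist (MeasureAut.Φ μ (S * R)⁻¹ c.vector) (MeasureAut.Φ μ (T * R)⁻¹ c.vector) =
      dist (MeasureAut.Φ μ S⁻¹ c.vector) (MeasureAut.Φ μ T⁻¹ c.vector)
    rw [mul_inv_rev, mul_inv_rev, MeasureAut.Φ_mul_apply, MeasureAut.Φ_mul_apply,
      LinearIsometryEquiv.dist_map]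

theorem metrizableSpace (c : UnitCoordinate μ) : MetrizableSpace (MeasureAut μ) :=
  (IsEmbedding.mk c.isInducing_vector c.injective_vector).metrizableSpace

/-! ### Permutations of cells in the strong topology -/

/-- The action of permutations of cells on `(X, μ)` modulo null sets. -/
def cellHom (n : ℕ) : Equiv.Perm (Fin (n + 1)) →* MeasureAut μ :=
  (QuotientGroup.mk' (BorelAut.null μ)).comp (c.cellAut n)

/-- Permutations that move few cells are close to the identity. -/
theorem exists_cellHom_mem {V : Set (MeasureAut μ)} (hV : V ∈ 𝓝 1) :
    ∃ δ : ℝ, 0 < δ ∧ ∀ (n : ℕ) (σ : Equiv.Perm (Fin (n + 1))),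
      (hammingCount σ⁻¹ 1 : ℝ) < δ * (n + 1) → c.cellHom n σ ∈ V := by
  rw [c.isInducing_vector.nhds_eq_comap, Metric.nhds_basis_ball.comap _ |>.mem_iff] at hV
  obtain ⟨ε, hε, hV⟩ := hV
  -- The squared `L²` displacement of the coordinate is at most the proportion of moved cells.
  refine ⟨ε ^ 2, by positivity, fun n σ hσ => hV ?_⟩
  rw [Set.mem_preimage, Metric.mem_ball, dist_eq_norm]
  refine lt_of_pow_lt_pow_left₀ 2 hε.le ?_
  change ‖BorelAut.unitaryOp (c.cellAut n σ) c.vector - BorelAut.unitaryOp 1 c.vector‖ ^ 2 < _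
  rw [c.norm_unitaryOp_sub_sq]
  have h1 : ∫ x, (c.toReal ((c.cellAut n σ).1.symm x) -
        c.toReal ((1 : BorelAut μ).1.symm x)) ^ 2 ∂μ =
      ∫ x, (cellShift n σ⁻¹ (c.toReal x) - c.toReal x) ^ 2 ∂μ := by
    refine integral_congr_ae (c.ae_toReal_mem.mono fun x hx => ?_)
    change (_ - c.toReal x) ^ 2 = _
    rw [c.toReal_cellAut_symm σ hx]
  have h2 : ∫ x, (cellShift n σ⁻¹ (c.toReal x) - c.toReal x) ^ 2 ∂μ =
      ∫ t, (cellShift n σ⁻¹ t - t) ^ 2 ∂unitMeasure := by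
    rw [← c.measurePreserving.map_eq, integral_map c.measurePreserving.measurable.aemeasurable]
    exact (((measurable_cellShift _).sub measurable_id).pow_const 2).aestronglyMeasurable
  rw [h1, h2]
  refine (integral_sub_cellShift_sq_le _).trans_lt ?_
  rwa [div_lt_iff₀ (by positivity)]

/-- Permutations of cells are eventually dense in `Aut (X, μ)`. -/
theorem eventually_exists_cellHom_mem {U : Set (MeasureAut μ)} {T : MeasureAut μ} (hU : U ∈ 𝓝 T) :
    ∀ᶠ n in atTop, ∃ σ, c.cellHom n σ ∈ U := by
  rw [c.isInducing_vector.nhds_eq_comap, Metric.nhds_basis_ball.comap _ |>.mem_iff] at hU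
  obtain ⟨ε, hε, hU⟩ := hU
  obtain ⟨T, rfl⟩ := QuotientGroup.mk_surjective T
  have hw : MeasurePreserving (c.toReal ∘ T.1.symm ∘ c.ofReal) unitMeasure unitMeasure :=
    c.measurePreserving.comp ((T⁻¹).2.comp c.measurePreserving_ofReal)
  filter_upwards [eventually_exists_perm_integral_lt hw (show 0 < ε ^ 2 by positivity)]
    with n ⟨ρ, hρ⟩
  -- The operator of an automorphism composes with its inverse, so `ρ` approximates the inverse of
  -- `T`. The tolerance is `ε ^ 2` because differences of coordinates are at most `1`, so their
  -- squares are dominated by their absolute values.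
  refine ⟨ρ⁻¹, hU ?_⟩
  rw [Set.mem_preimage, Metric.mem_ball, dist_comm, dist_eq_norm]
  refine lt_of_pow_lt_pow_left₀ 2 hε.le ?_
  change ‖BorelAut.unitaryOp T c.vector - BorelAut.unitaryOp (c.cellAut n ρ⁻¹) c.vector‖ ^ 2 < _
  rw [c.norm_unitaryOp_sub_sq]
  refine lt_of_le_of_lt ?_ hρ
  have hmeas : Measurable fun t =>
      |(c.toReal ∘ T.1.symm ∘ c.ofReal) t - cellShift n ρ t| :=
    (hw.measurable.sub (measurable_cellShift ρ)).abs
  rw [← c.measurePreserving.map_eq, integral_map c.measurePreserving.measurable.aemeasurable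
    hmeas.aestronglyMeasurable]
  have hae : ∀ᵐ x ∂μ, |(c.toReal ∘ T.1.symm ∘ c.ofReal) (c.toReal x) -
      cellShift n ρ (c.toReal x)| = |c.toReal (T.1.symm x) -
        c.toReal ((c.cellAut n ρ⁻¹).1.symm x)| ∧
      |c.toReal (T.1.symm x) - c.toReal ((c.cellAut n ρ⁻¹).1.symm x)| ≤ 1 := by
    filter_upwards [c.ae_toReal_mem, (T⁻¹).2.quasiMeasurePreserving.ae c.ae_toReal_mem_Ico]
      with x h1 h2
    have h2' : c.toReal (T.1.symm x) ∈ Set.Ico (0 : ℝ) 1 := h2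
    have h3 := cellShift_mem ρ (c.domain_subset h1)
    rw [c.toReal_cellAut_symm _ h1, inv_inv]
    constructor
    · simp only [Function.comp_apply]
      rw [c.ofReal_toReal x h1]
    · rw [abs_le]
      constructor <;> linarith [h2'.1, h2'.2, h3.1, h3.2]
  refine integral_mono_of_nonneg (.of_forall fun _ => sq_nonneg _) ?_ ?_
  · refine integrable_of_measurable_of_mem (C := 1)
      (hmeas.comp c.measurePreserving.measurable) (hae.mono fun x hx => ?_)
    rw [abs_abs, hx.1]
    exact hx.2
  · filter_upwards [hae] with x hx
    rw [hx.1, ← sq_abs]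
    nlinarith [hx.2, abs_nonneg (c.toReal (T.1.symm x) - c.toReal ((c.cellAut n ρ⁻¹).1.symm x))]

end UnitCoordinate

end StrongTopology

/-! ### Groups that are approximated by symmetric groups -/

section PermApprox

open scoped Uniformity SetRel

open Classical in
/-- A sequence of homomorphisms from the symmetric groups to `G` that concentrates with respect to
neighbourhoods of the identity and has dense union of images. -/
structure IsPermApproximation {G : Type*} [Group G] [TopologicalSpace G]
    (f : ∀ n, Equiv.Perm (Fin (n + 1)) →* G) : Prop where
  concentration : ∀ V ∈ 𝓝 (1 : G), ∀ a η : ℝ, 0 < a → 0 < η → ∀ᶠ n in atTop,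
    ∀ A : Finset (Equiv.Perm (Fin (n + 1))), a * (n + 1).factorial ≤ A.card →
      (1 - η) * (n + 1).factorial ≤
        (Finset.univ.filter fun σ => ∃ τ ∈ A, f n σ * (f n τ)⁻¹ ∈ V).card
  dense : ∀ g : G, ∀ U ∈ 𝓝 g, ∀ᶠ n in atTop, ∃ σ, f n σ ∈ U

/-- The substitution `j = σ i` matches the points moved by `τ * σ⁻¹` with the points where `σ` and
`τ` differ. -/
theorem hammingCount_mul_inv {n : ℕ} (σ τ : Equiv.Perm (Fin n)) :
    hammingCount (σ * τ⁻¹)⁻¹ 1 = hammingCount σ τ := by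
  refine (Finset.card_equiv σ fun i => ?_).symm
  simp only [Finset.mem_filter, Finset.mem_univ, true_and]
  simp [eq_comm]

theorem UnitCoordinate.isPermApproximation {X : Type u} [MeasurableSpace X] {μ : Measure X}
    [IsProbabilityMeasure μ] (c : UnitCoordinate μ) : IsPermApproximation c.cellHom where
  dense _ _ hU := c.eventually_exists_cellHom_mem hU
  concentration V hV a η ha hη := by
    classical
    obtain ⟨δ, hδ, h⟩ := c.exists_cellHom_mem hV
    have t1 : Tendsto (fun n : ℕ => a * δ ^ 2 * ((n + 1 : ℕ) : ℝ)) atTop atTop :=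
      (tendsto_natCast_atTop_atTop.comp (tendsto_add_atTop_nat 1)).const_mul_atTop (by positivity)
    have t2 : Tendsto (fun n : ℕ => η * δ ^ 2 * ((n + 1 : ℕ) : ℝ)) atTop atTop :=
      (tendsto_natCast_atTop_atTop.comp (tendsto_add_atTop_nat 1)).const_mul_atTop (by positivity)
    filter_upwards [t1.eventually_ge_atTop 16, t2.eventually_ge_atTop 16] with n h1 h2 A hA
    refine (Equiv.Perm.concentration ha hδ n.succ_pos h1 h2 A hA).trans ?_
    refine Nat.cast_le.mpr (Finset.card_le_card fun σ hσ => ?_)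
    obtain ⟨τ, hτ, hστ⟩ := (Finset.mem_filter.mp hσ).2
    refine Finset.mem_filter.mpr ⟨Finset.mem_univ _, τ, hτ, ?_⟩
    rw [← map_inv, ← map_mul]
    refine h n _ ?_
    rw [hammingCount_mul_inv]
    exact_mod_cast hστ

open Classical in
/-- The normalized Haar measure of the image of a finite group is the push-forward of the uniform
measure. -/
theorem compactHaar_range_apply {G H : Type*} [Group G] [TopologicalSpace G] [IsTopologicalGroup G]
    [T2Space G] [MeasurableSpace G] [BorelSpace G] [Group H] [Fintype H] (f : H →* G)
    (hK : IsCompact (f.range : Set G)) {B : Set G} (hB : MeasurableSet B) :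
    compactHaar f.range hK B =
      (Fintype.card H : ℝ≥0∞)⁻¹ * (Finset.univ.filter fun h => f h ∈ B).card := by
  have hcpt : CompactSpace f.range := isCompact_iff_compactSpace.mp hK
  have hfin : Finite f.range := Set.finite_range f
  let mH : MeasurableSpace H := ⊤
  let ν : Measure f.range :=
    ((Fintype.card H : ℝ≥0∞)⁻¹ • (Measure.count : Measure H)).map f.rangeRestrict
  have hmeas : Measurable f.rangeRestrict := measurable_from_top
  -- The image of the uniform measure under a surjective homomorphism is an invariant probability
  -- measure, so uniqueness of Haar measure identifies it.
  have hinv : ν.IsMulLeftInvariant :=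
    isMulLeftInvariant_map f.rangeRestrict.toMulHom hmeas f.rangeRestrict_surjective
  have hν : ∀ s, MeasurableSet s → ν s =
      (Fintype.card H : ℝ≥0∞)⁻¹ * (Finset.univ.filter fun h => f.rangeRestrict h ∈ s).card := by
    intro s hs
    rw [Measure.map_apply hmeas hs, Measure.smul_apply, smul_eq_mul,
      Measure.count_apply_finite _ (Set.toFinite _)]
    congr 3
    ext h
    simp
  have hprob : IsProbabilityMeasure ν := ⟨by
    rw [hν _ MeasurableSet.univ]
    simp only [Set.mem_univ, Finset.filter_true, Finset.card_univ]
    exact ENNReal.inv_mul_cancel (by simp) (by simp)⟩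
  have huniq := Measure.haarMeasure_unique ν (⊤ : PositiveCompacts f.range)
  rw [PositiveCompacts.coe_top, measure_univ, one_smul] at huniq
  have hdef : compactHaar f.range hK =
      (Measure.haarMeasure (⊤ : PositiveCompacts f.range)).map Subtype.val := rfl
  rw [hdef, ← huniq, Measure.map_apply measurable_subtype_coe hB,
    hν _ (measurable_subtype_coe hB)]
  rfl

theorem isCompact_range_of_finite {G H : Type*} [Group G] [TopologicalSpace G] [Group H] [Finite H]
    (f : H →* G) : IsCompact (f.range : Set G) :=
  (Set.finite_range f).isCompact

/-- A permutation approximation yields a Lévy net. -/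
theorem IsPermApproximation.isLevyFamily_and_dense {G : Type u} [Group G] [MetricSpace G]
    [IsTopologicalGroup G] [MeasurableSpace G] [BorelSpace G]
    (hd : ∀ a b c : G, dist (a * c) (b * c) = dist a b)
    {f : ∀ n, Equiv.Perm (Fin (n + 1)) →* G} (hf : IsPermApproximation f)
    (hK : ∀ α : ULift.{u} ℕ, IsCompact ((f α.down).range : Set G)) :
    IsLevyFamily (fun _ : ULift.{u} ℕ => G) (fun α => compactHaar (f α.down).range (hK α)) ∧
    ∀ (F : Finset G) (ε : ℝ), 0 < ε → ∃ α : ULift.{u} ℕ, ∀ β, α ≤ β → ∀ g ∈ F,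
      Metric.infDist g ((f β.down).range : Set G) < ε := by
  classical
  have hdown : Tendsto (ULift.down : ULift.{u} ℕ → ℕ) atTop atTop :=
    tendsto_atTop_atTop.mpr fun b => ⟨⟨b⟩, fun _ h => h⟩
  have hfac : ∀ n : ℕ, (0 : ℝ) < (n + 1).factorial := fun n => by
    exact_mod_cast Nat.factorial_pos _
  have happly : ∀ (α : ULift.{u} ℕ) (B : Set G), MeasurableSet B →
      compactHaar (f α.down).range (hK α) B = ENNReal.ofReal
        ((Finset.univ.filter fun σ => f α.down σ ∈ B).card / (α.down + 1).factorial) := by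
    intro α B hB
    rw [compactHaar_range_apply _ _ hB, ENNReal.ofReal_div_of_pos (hfac _), Fintype.card_perm,
      Fintype.card_fin, ENNReal.ofReal_natCast, ENNReal.ofReal_natCast, mul_comm,
      ENNReal.div_eq_inv_mul, mul_comm]
  have hprob : ∀ α : ULift.{u} ℕ,
      IsProbabilityMeasure (compactHaar (f α.down).range (hK α)) := by
    intro α
    refine ⟨?_⟩
    rw [happly α _ MeasurableSet.univ]
    simp only [Set.mem_univ, Finset.filter_true, Finset.card_univ, Fintype.card_perm,
      Fintype.card_fin]
    rw [div_self (hfac _).ne', ENNReal.ofReal_one]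
  refine ⟨⟨hprob, fun A hA hlim ε hε => ?_⟩, fun F ε hε => ?_⟩
  · obtain ⟨a, ha0, ha⟩ := exists_between hlim
    have hatop : a ≠ ⊤ := ha.ne_top
    have hev := eventually_lt_of_lt_liminf ha
    have ha0' : 0 < a.toReal := ENNReal.toReal_pos ha0.ne' hatop
    refine tendsto_order.mpr ⟨fun b hb => ?_, fun b hb => ?_⟩
    · have hb' : b.toReal < 1 := by
        rw [← ENNReal.toReal_one]
        exact (ENNReal.toReal_lt_toReal hb.ne_top ENNReal.one_ne_top).mpr hb
      -- With `η = (1 - b) / 2` the bound `1 - η` exceeds `b`. Right invariance turns `g * h⁻¹ ∈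
      -- ball 1 ε` into `dist g h < ε`.
      have hconc := hf.concentration (Metric.ball 1 ε) (Metric.ball_mem_nhds 1 hε) a.toReal
        ((1 - b.toReal) / 2) ha0' (by linarith)
      filter_upwards [hev, hdown.eventually hconc] with α h1 h2
      rw [happly α _ (hA α)] at h1
      have h3 : a.toReal * (α.down + 1).factorial ≤
          (Finset.univ.filter fun σ => f α.down σ ∈ A α).card := by
        rw [← le_div_iff₀ (hfac _)]
        exact (ENNReal.lt_ofReal_iff_toReal_lt hatop).mp h1 |>.le
      have h4 := h2 _ h3
      rw [happly α _ Metric.isOpen_thickening.measurableSet,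
        ENNReal.lt_ofReal_iff_toReal_lt hb.ne_top, lt_div_iff₀ (hfac _)]
      have h5 : ((Finset.univ.filter fun σ => ∃ τ ∈ Finset.univ.filter
            (fun σ => f α.down σ ∈ A α), f α.down σ * (f α.down τ)⁻¹ ∈ Metric.ball 1 ε).card : ℝ) ≤
          (Finset.univ.filter fun σ => f α.down σ ∈ Metric.thickening ε (A α)).card := by
        refine Nat.cast_le.mpr (Finset.card_le_card fun σ hσ => ?_)
        obtain ⟨τ, hτ, hστ⟩ := (Finset.mem_filter.mp hσ).2
        refine Finset.mem_filter.mpr ⟨Finset.mem_univ _, Metric.mem_thickening_iff.mpr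
          ⟨f α.down τ, (Finset.mem_filter.mp hτ).2, ?_⟩⟩
        rw [Metric.mem_ball, ← hd _ _ (f α.down τ), inv_mul_cancel_right, one_mul] at hστ
        exact hστ
      have h6 : b.toReal * (α.down + 1).factorial <
          (1 - (1 - b.toReal) / 2) * (α.down + 1).factorial := by
        have := hfac α.down
        gcongr
        linarith
      linarith
    · exact .of_forall fun α => prob_le_one.trans_lt hb
  · have hev : ∀ᶠ n in atTop, ∀ g ∈ F, ∃ σ, f n σ ∈ Metric.ball g ε :=
      (Filter.eventually_all_finset F).mpr fun g _ =>
        hf.dense g _ (Metric.ball_mem_nhds g hε)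
    obtain ⟨α, hα⟩ := eventually_atTop.mp (hdown.eventually hev)
    refine ⟨α, fun β hβ g hg => ?_⟩
    obtain ⟨σ, hσ⟩ := hα β hβ g hg
    rw [Metric.mem_ball, dist_comm] at hσ
    have hmem : f β.down σ ∈ ((f β.down).range : Set G) := ⟨σ, rfl⟩
    exact (Metric.infDist_le_dist_of_mem hmem).trans_lt hσ

/-! ### From concentration to fixed points -/

/-- For a group with a permutation approximation acting on a compact space, every finite subset of
the group has almost fixed points. -/
theorem IsPermApproximation.exists_almost_fixed {G : Type*} [Group G] [TopologicalSpace G]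
    [IsTopologicalGroup G] {f : ∀ n, Equiv.Perm (Fin (n + 1)) →* G} (hf : IsPermApproximation f)
    {Y : Type*} [UniformSpace Y] [CompactSpace Y] [Nonempty Y] [MulAction G Y] [ContinuousSMul G Y]
    (F : Finset G) {W : SetRel Y Y} (hW : W ∈ 𝓤 Y) : ∃ y : Y, ∀ g ∈ F, (y, g • y) ∈ W := by
  classical
  obtain ⟨W₁, hW₁, -, hWW₁⟩ := comp_symm_mem_uniformity_sets hW
  obtain ⟨W₂, hW₂, hs₂, hWW₂⟩ := comp_symm_mem_uniformity_sets hW₁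
  obtain ⟨W₃, hW₃, hs₃, hWW₃⟩ := comp_symm_mem_uniformity_sets hW₂
  have hW₃₁ : W₃ ⊆ W₁ :=
    (subset_comp_self_of_mem_uniformity hW₃).trans
      (hWW₃.trans ((subset_comp_self_of_mem_uniformity hW₂).trans hWW₂))
  -- By compactness of `Y`, group elements near the identity move all points by less than `W₃`
  -- simultaneously.
  have hV : ∀ᶠ v in 𝓝 (1 : G), ∀ y ∈ (Set.univ : Set Y), (y, v • y) ∈ W₃ := by
    refine isCompact_univ.eventually_forall_of_forall_eventually fun y _ => ?_
    have hc : Continuous fun p : G × Y => (p.2, p.1 • p.2) := by fun_prop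
    have h := hc.tendsto (1, y)
    simp only [one_smul] at h
    exact h (nhds_le_uniformity y hW₃)
  obtain ⟨y₀⟩ := ‹Nonempty Y›
  obtain ⟨t, ht, hcov⟩ := (isCompact_univ (X := Y)).totallyBounded W₃ hW₃
  lift t to Finset Y using ht
  have hcov' : ∀ y, ∃ c ∈ t, (y, c) ∈ W₃ := by
    intro y
    have := hcov (Set.mem_univ y)
    simpa using this
  have htc : (0 : ℝ) < t.card := by
    obtain ⟨c, hc, -⟩ := hcov' y₀
    exact_mod_cast Finset.card_pos.mpr ⟨c, hc⟩
  have hdense : ∀ᶠ n in atTop, ∀ g ∈ F, ∃ ρ, f n ρ ∈ {k : G | g * k⁻¹ ∈ {v : G |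
      ∀ y ∈ (Set.univ : Set Y), (y, v • y) ∈ W₃}} := by
    refine (Filter.eventually_all_finset F).mpr fun g _ => hf.dense g _ ?_
    have hc : Continuous fun k : G => g * k⁻¹ := by fun_prop
    have h := hc.tendsto g
    rw [mul_inv_cancel] at h
    exact h hV
  -- The proportion `1 / t.card` is what the pigeonhole principle gives for one member of the finite
  -- `W₃`-net `t`. The defect `1 / (2 * (F.card + 1))` is small enough for `F.card + 1` translates
  -- of the bad set to fill at most half of the group.
  obtain ⟨n, hn1, hn2⟩ := ((hf.concentration _ hV (1 / t.card) (1 / (2 * (F.card + 1)))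
    (by positivity) (by positivity)).and hdense).exists
  have hfac : (0 : ℝ) < (n + 1).factorial := by exact_mod_cast Nat.factorial_pos _
  have hcard : ((Finset.univ : Finset (Equiv.Perm (Fin (n + 1)))).card : ℝ) =
      (n + 1).factorial := by
    rw [Finset.card_univ, Fintype.card_perm, Fintype.card_fin]
  obtain ⟨c, hct, hc⟩ : ∃ c ∈ t, 1 / (t.card : ℝ) * (n + 1).factorial ≤
      (Finset.univ.filter fun σ => (f n σ • y₀, c) ∈ W₃).card := by
    refine Finset.exists_le_of_sum_le (Finset.card_pos.mp (by exact_mod_cast htc)) ?_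
    rw [Finset.sum_const, nsmul_eq_mul, ← Nat.cast_sum]
    have h1 : (t.card : ℝ) * (1 / t.card * (n + 1).factorial) = (n + 1).factorial := by
      field_simp
    rw [h1, ← hcard]
    refine Nat.cast_le.mpr ((Finset.card_le_card fun σ _ => ?_).trans Finset.card_biUnion_le)
    obtain ⟨c, hc, h⟩ := hcov' (f n σ • y₀)
    exact Finset.mem_biUnion.mpr ⟨c, hc, Finset.mem_filter.mpr ⟨Finset.mem_univ _, h⟩⟩
  have hB := hn1 _ hc
  set B := Finset.univ.filter fun σ => ∃ τ ∈ Finset.univ.filter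
    (fun σ => (f n σ • y₀, c) ∈ W₃), f n σ * (f n τ)⁻¹ ∈ {v : G |
      ∀ y ∈ (Set.univ : Set Y), (y, v • y) ∈ W₃} with hBdef
  have hBW : ∀ σ ∈ B, (f n σ • y₀, c) ∈ W₂ := by
    intro σ hσ
    obtain ⟨τ, hτ, hστ⟩ := (Finset.mem_filter.mp hσ).2
    have h1 := hστ (f n τ • y₀) (Set.mem_univ _)
    rw [smul_smul, inv_mul_cancel_right] at h1
    exact hWW₃ (SetRel.prodMk_mem_comp (SetRel.symm W₃ h1) (Finset.mem_filter.mp hτ).2)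
  choose! ρ hρ using hn2
  let S : Finset (Equiv.Perm (Fin (n + 1))) := insert 1 (F.image ρ)
  have hScard : S.card ≤ F.card + 1 :=
    (Finset.card_insert_le _ _).trans (Nat.add_le_add_right Finset.card_image_le 1)
  -- Counting yields a `σ` for which `σ` and every `ρ g * σ` lie in `B`: the excluded set for each
  -- factor is a translate of the complement of `B`.
  obtain ⟨σ, hσ⟩ : ∃ σ, σ ∉ S.biUnion fun r => Bᶜ.image fun s => r⁻¹ * s := by
    by_contra! hall
    have h1 : (n + 1).factorial ≤ S.card * Bᶜ.card := by
      have h0 : (Finset.univ : Finset (Equiv.Perm (Fin (n + 1)))).card = (n + 1).factorial := by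
        exact_mod_cast hcard
      rw [← h0, ← Finset.eq_univ_of_forall hall]
      exact Finset.card_biUnion_le_card_mul _ _ _ fun _ _ => Finset.card_image_le
    have h2 : ((n + 1).factorial : ℝ) ≤ (F.card + 1) * Bᶜ.card := by
      exact_mod_cast h1.trans (Nat.mul_le_mul_right _ hScard)
    have h3 : (B.card : ℝ) + Bᶜ.card = (n + 1).factorial := by
      rw [← hcard]
      exact_mod_cast Finset.card_add_card_compl B
    have h4 : (Bᶜ.card : ℝ) ≤ 1 / (2 * (F.card + 1)) * (n + 1).factorial := by linarith
    have h5 : ((F.card : ℝ) + 1) * Bᶜ.card ≤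
        (F.card + 1) * (1 / (2 * (F.card + 1)) * (n + 1).factorial) := by gcongr
    have h6 : ((F.card : ℝ) + 1) * (1 / (2 * (F.card + 1)) * (n + 1).factorial) =
        (n + 1).factorial / 2 := by field_simp
    linarith
  have hσS : ∀ r ∈ S, (f n (r * σ) • y₀, c) ∈ W₂ := by
    intro r hr
    refine hBW _ ?_
    by_contra hnot
    refine hσ (Finset.mem_biUnion.mpr ⟨r, hr, Finset.mem_image.mpr
      ⟨r * σ, Finset.mem_compl.mpr hnot, inv_mul_cancel_left r σ⟩⟩)
  refine ⟨f n σ • y₀, fun g hg => ?_⟩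
  have h1 := hσS 1 (Finset.mem_insert_self _ _)
  have h2 := hσS (ρ g) (Finset.mem_insert_of_mem (Finset.mem_image_of_mem ρ hg))
  have h3 := hρ g hg (f n (ρ g) • f n σ • y₀) (Set.mem_univ _)
  rw [smul_smul (g * _), inv_mul_cancel_right] at h3
  rw [one_mul] at h1
  rw [map_mul, mul_smul] at h2
  -- With `y = f n σ • y₀`, both `y` and `f n (ρ g) • y` are `W₂`-close to `c`, and `f n (ρ g) • y`
  -- is `W₃`-close to `g • y`.
  exact hWW₁ (SetRel.prodMk_mem_comp
    (hWW₂ (SetRel.prodMk_mem_comp h1 (SetRel.symm W₂ h2))) (hW₃₁ h3))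

theorem IsPermApproximation.isExtremelyAmenable {G : Type u} [Group G] [TopologicalSpace G]
    [IsTopologicalGroup G] {f : ∀ n, Equiv.Perm (Fin (n + 1)) →* G} (hf : IsPermApproximation f) :
    IsExtremelyAmenable.{u, v} G := by
  intro Y _ _ _ _ _ _
  classical
  let _ : UniformSpace Y := uniformSpaceOfCompactR1
  let Z : G × {W : SetRel Y Y // W ∈ 𝓤 Y ∧ IsClosed W} → Set Y :=
    fun i => {y | (y, i.1 • y) ∈ i.2.1}
  have hZ : ∀ i, IsClosed (Z i) := fun i =>
    i.2.2.2.preimage (continuous_id.prodMk (continuous_const_smul i.1))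
  -- Almost fixed points give the finite intersection property for the closed sets `Z (g, W)`. A
  -- point of all of them is fixed, because the closed entourages of a Hausdorff space meet in the
  -- diagonal.
  obtain ⟨y, -, hy⟩ := isCompact_univ.inter_iInter_nonempty Z hZ fun u => by
    have hW : (⋂ i ∈ u, i.2.1) ∈ 𝓤 Y := (biInter_finset_mem u).mpr fun i _ => i.2.2.1
    obtain ⟨y, hy⟩ := hf.exists_almost_fixed (u.image Prod.fst) hW
    refine ⟨y, Set.mem_univ _, Set.mem_iInter₂.mpr fun i hi => ?_⟩
    exact Set.mem_iInter₂.mp (hy i.1 (Finset.mem_image_of_mem _ hi)) i hi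
  refine ⟨y, fun g => ?_⟩
  refine (eq_of_uniformity_basis uniformity_hasBasis_closed fun {W} hW => ?_).symm
  exact Set.mem_iInter.mp hy (g, ⟨W, hW⟩)

end PermApprox

end

theorem theorem3p1 {X : Type u} [MeasurableSpace X] [StandardBorelSpace X]
    (μ : Measure X) [IsProbabilityMeasure μ] [NullSingletonClass μ] :
    IsLevyGroup (MeasureAut μ) ∧ IsExtremelyAmenable.{u, v} (MeasureAut μ) := by
  obtain ⟨c⟩ := nonempty_unitCoordinate μ
  have hc := c.isPermApproximation
  -- The net is a sequence; `ULift` only places its index set in the universe that `IsLevyGroup`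
  -- demands.
  refine ⟨⟨MeasureAut.isTopologicalGroup, c.metrizableSpace,
    ⟨c.autMetric, c.isCompatibleRightInvariant_autMetric⟩, ULift.{u} ℕ, inferInstance,
    inferInstance, inferInstance, fun α => (c.cellHom α.down).range,
    fun α => isCompact_range_of_finite _, fun d hd => ?_⟩, hc.isExtremelyAmenable⟩
  let _ : MeasurableSpace (MeasureAut μ) := borel (MeasureAut μ)
  have _ : BorelSpace (MeasureAut μ) := ⟨rfl⟩
  let _ : MetricSpace (MeasureAut μ) := d.replaceTopology hd.compatible
  exact hc.isLevyFamily_and_dense hd.right_invariant _
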